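/- \textbf{Theorem (secure computing capacity of a branch).} \emph{Network and model.} Let $V\ge 1$, $\alpha\ge 1$, $r\ge 0$ be integers and $\mathbb F_q$ any finite field. The branch $\mathcal N$ is the directed acyclic multigraph with source nodes $\sigma_1,\dots,\sigma_V$, one middle node and a sink $\gamma$, with $\alpha$ parallel edges from each source to the middle node and $\alpha$ parallel edges from the middle node to $\gamma$; $S$ is the set of sources and $\mathcal E$ the set of edges. Let $\mathbf F$ and $\mathbf G$ be matrices over $\mathbb F_q$ with $V$ rows, let $\langle\mathbf F\rangle,\langle\mathbf G\rangle$ be their column spaces, assume $\langle\mathbf F\rangle\cap\langle\mathbf G\rangle\ne\{\mathbf 0\}$, and put $r_f=\operatorname{rank}\mathbf F$. The target function is $f(\mathbf x)=\mathbf x\mathbf F$ and the security function is $g(\mathbf x)=\mathbf x\mathbf G$, $\mathbf x\in\mathbb F_q^{V}$. An $(\ell,n)$ code ($\ell\ge 0$, $n\ge1$): source $\sigma_i$ holds a message $M_i\in\mathbb F_q^\ell$ and a key $K_i$ from a nonempty finite set, all messages and keys being uniform and independent; every edge carries a vector in $\mathbb F_q^n$ that is a function of $(M_i,K_i)$ if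 its tail is $\sigma_i$, and of the vectors received by its tail otherwise; the sink applies a decoding function to the vectors it receives. The code is admissible if the sink always recovers the $\ell$ values of $f$ (one for each message coordinate), and $I(Y_W;g(M_S))=0$ for every $W\subseteq\mathcal E$ with $|W|\le r$, where $Y_W$ denotes the vectors on $W$ and $g(M_S)$ the $\ell$ values of $g$. A real $R\ge0$ is achievable if for every $\varepsilon>0$ there is an admissible $(\ell,n)$ code with $\ell/n>R-\varepsilon$; the secure computing capacity $\widehat{\mathcal C}(\mathcal N,f,g,r)$ is the largest achievable $R$. A code is linear if its keys are vectors over $\mathbb F_q$ and its edge encodings are $\mathbb F_q$-linear. \emph{Cuts and validity.} For $C\subseteq\mathcal E$ let $D_C$ be the set of sources having a directed path to $\gamma$ that uses an edge of $C$, $I_C$ the set of sources having no path to $\gamma$ after $C$ is deleted, and $J_C=D_C\setminus I_C$. $C$ is a cut if $I_C\neq\emptyset$. A partition $\mathcal P=\{C_1,\dots,C_p\}$ of a cut $C$ is weak if, for every $i$, $I_{C_i}\ne\emptyset$ and $D_{C_i}\subseteq I_{C_i}\cup J_C\cup L$, where $L=I_C\setminus\bigcup_j I_{C_j}$. For $A\subseteq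 S$ let $\mathbf F_A$ be $\mathbf F$ with the rows outside $A$ replaced by zero, and for a weak partition put \[ t_{C,f,g}=\dim\bigl((\langle\mathbf F_{I_{C_1}}\rangle+\dots+\langle\mathbf F_{I_{C_p}}\rangle)\cap\langle\mathbf G\rangle\bigr).\] A pair $(C,W)$ with $C$ a cut and $|W|\le r$ is valid, with respect to a weak partition of $C$, if $t_{C,f,g}>0$, $W\subseteq C$ and $D_W\subseteq\bigcup_j I_{C_j}$. A triple $(C,B,W)$ with $C$ a cut, $B\subseteq\mathcal E$ and $|W|\le r$ is valid, with respect to a weak partition of $C$, if every directed path with at least one edge from a source in $J_C$ to the tail of an edge of $C$ contains an edge of $B$, and moreover $D_B=J_C$, $t_{C,f,g}>0$, $W\subseteq C\cup B$ and $D_W\subseteq\bigcup_j I_{C_j}\cup J_C$. \emph{Statement.} The minima below, taken over all valid pairs and all valid triples together with the weak partitions with respect to which they are valid, and the capacity exist, and \[\widehat{\mathcal C}(\mathcal N,f,g,r)=\min\left\{\frac{\alpha}{r_f},\ \min_{(C,W)\text{ valid}}\frac{|C|-|W|}{t_{C,f,g}},\ \min_{(C,B,W)\text{ valid}}\frac{|C\cup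 B|-|W|}{t_{C,f,g}}\right\}.\] Moreover, some admissible linear $(\ell,n)$ code over $\mathbb F_q$ has rate $\ell/n$ equal to this capacity. -/

import Mathlib

universe u v w x

namespace SecureComputation

open MeasureTheory

/-! ### Networks -/

/-- `IsPath tail head a p b`: the nonempty edge sequence `p` is a directed path from `a` to `b`. -/
inductive IsPath {𝒱 ℰ : Type*} (tail head : ℰ → 𝒱) : 𝒱 → List ℰ → 𝒱 → Prop
  | single (e : ℰ) : IsPath tail head (tail e) [e] (head e)
  | cons (e : ℰ) (p : List ℰ) (b : 𝒱) :
      IsPath tail head (head e) p b → IsPath tail head (tail e) (e :: p) b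

/-- A network on a finite directed acyclic multigraph with vertices `𝒱`, edges `ℰ`, source nodes
indexed by `S` and one sink node. -/
structure Network (𝒱 ℰ S : Type) [Finite 𝒱] [Finite ℰ] [Finite S] where
  tail : ℰ → 𝒱
  head : ℰ → 𝒱
  source : S ↪ 𝒱
  sink : 𝒱
  source_ne_sink : ∀ i, source i ≠ sink
  acyclic : ∀ a p, ¬ IsPath tail head a p a
  source_no_in : ∀ i e, head e ≠ source i
  path_to_sink : ∀ a, a ≠ sink → ∃ p, IsPath tail head a p sink

namespace Network

variable {𝒱 ℰ S : Type} [Finite 𝒱] [Finite ℰ] [Finite S] (N : Network 𝒱 ℰ S)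

/-- `N.Path a p b`: the edge sequence `p` is a directed path from `a` to `b` in `N`. -/
def Path (a : 𝒱) (p : List ℰ) (b : 𝒱) : Prop := IsPath N.tail N.head a p b

/-- The edge `d` immediately precedes the edge `e`. -/
def Precedes (d e : ℰ) : Prop := N.head d = N.tail e

theorem exists_path_of_transGen {d e : ℰ} (h : Relation.TransGen N.Precedes d e) :
    ∃ p, N.Path (N.head d) p (N.head e) := by
  induction h using Relation.TransGen.head_induction_on with
  | single h =>
    refine ⟨[e], ?_⟩
    have h' : N.head _ = N.tail e := h
    rw [h']
    exact IsPath.single e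
  | head h _ ih =>
    rename_i x y _
    obtain ⟨p, hp⟩ := ih
    refine ⟨y :: p, ?_⟩
    have h' : N.head x = N.tail y := h
    rw [h']
    exact IsPath.cons _ p _ hp

theorem precedes_wellFounded : WellFounded N.Precedes := by
  have hirr : Std.Irrefl (Relation.TransGen N.Precedes) :=
    ⟨fun e h => by
      obtain ⟨p, hp⟩ := N.exists_path_of_transGen h
      exact N.acyclic _ p hp⟩
  have hwf : WellFounded (Relation.TransGen N.Precedes) :=
    Finite.wellFounded_of_trans_of_irrefl _
  exact Subrelation.wf (fun h => Relation.TransGen.single h) hwf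

/-- `D_C`: sources having a directed path to the sink that contains an edge of `C`. -/
def D (C : Finset ℰ) : Set S :=
  {i | ∃ p, N.Path (N.source i) p N.sink ∧ ∃ e ∈ p, e ∈ C}

/-- `I_C`: sources having no path to the sink once the edges of `C` are deleted. -/
def I (C : Finset ℰ) : Set S :=
  {i | ¬ ∃ p, N.Path (N.source i) p N.sink ∧ ∀ e ∈ p, e ∉ C}

/-- `J_C = D_C \ I_C`. -/
def J (C : Finset ℰ) : Set S := N.D C \ N.I C

/-- `C` is a cut of the network: it separates the sink from some source. -/
def IsCut (C : Finset ℰ) : Prop :=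
  ∃ i, ∀ p, N.Path (N.source i) p N.sink → ∃ e ∈ p, e ∈ C

/-- `B` is a cut between `J_C` and `C`: it separates the tails of the edges of `C` from `J_C`. -/
def IsCutBetween (B C : Finset ℰ) : Prop :=
  ∀ i ∈ N.J C, ∀ e ∈ C, ∀ p, N.Path (N.source i) p (N.tail e) → ∃ b ∈ p, b ∈ B

variable [DecidableEq ℰ]

/-- The union `I_{C_1} ∪ ⋯ ∪ I_{C_p}` over the parts of a partition of `C`. -/
def unionI {C : Finset ℰ} (P : Finpartition C) : Set S := ⋃ X ∈ P.parts, N.I X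

/-- Weak partitions of `C`; here `L = I_C \ (I_{C_1} ∪ ⋯ ∪ I_{C_p})`. -/
def IsWeakPartition {C : Finset ℰ} (P : Finpartition C) : Prop :=
  ∀ X ∈ P.parts, (N.I X).Nonempty ∧ N.D X ⊆ N.I X ∪ N.J C ∪ (N.I C \ N.unionI P)

end Network

/-! ### Column spaces and the two families of bounds -/

section Bounds

variable {𝒱 ℰ S : Type} [Finite 𝒱] [Finite ℰ] [Finite S] [DecidableEq ℰ]
  {K : Type u} [Field K] {ι : Type v} {κ : Type w}

/-- The subspace `⟨F⟩` spanned by the columns of `F`. -/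
def colSpan (F : Matrix S ι K) : Submodule K (S → K) :=
  Submodule.span K (Set.range fun j : ι => fun i : S => F i j)

open Classical in
/-- `F_A`: the rows of `F` outside `A` are replaced by zero. -/
noncomputable def restrictRows (F : Matrix S ι K) (A : Set S) : Matrix S ι K :=
  Matrix.of fun i j => if i ∈ A then F i j else 0

/-- `(⟨F_{I_{C_1}}⟩ + ⋯ + ⟨F_{I_{C_p}}⟩) ∩ ⟨G⟩` for the parts `C_1, …, C_p` of `P`. -/
noncomputable def commonSpace (N : Network 𝒱 ℰ S) (F : Matrix S ι K) (G : Matrix S κ K)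
    {C : Finset ℰ} (P : Finpartition C) : Submodule K (S → K) :=
  (⨆ X ∈ P.parts, colSpan (restrictRows F (N.I X))) ⊓ colSpan G

/-- `t_{C,f,g}`, for the weak partition `P` of `C`. -/
noncomputable def tDim (N : Network 𝒱 ℰ S) (F : Matrix S ι K) (G : Matrix S κ K)
    {C : Finset ℰ} (P : Finpartition C) : ℕ :=
  Module.finrank K (commonSpace N F G P)

/-- The pair `(C, W)` is valid, as witnessed by the weak partition `P`, at security level `r`. -/
structure ValidPair (N : Network 𝒱 ℰ S) (F : Matrix S ι K) (G : Matrix S κ K) (r : ℕ)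
    (C W : Finset ℰ) (P : Finpartition C) : Prop where
  isCut : N.IsCut C
  card_le : W.card ≤ r
  weak : N.IsWeakPartition P
  common : commonSpace N F G P ≠ ⊥
  subset : W ⊆ C
  sources : N.D W ⊆ N.unionI P

/-- The triple `(C, B, W)` is valid, as witnessed by the weak partition `P`, at level `r`. -/
structure ValidTriple (N : Network 𝒱 ℰ S) (F : Matrix S ι K) (G : Matrix S κ K) (r : ℕ)
    (C B W : Finset ℰ) (P : Finpartition C) : Prop where
  isCut : N.IsCut C
  isCutBetween : N.IsCutBetween B C
  card_le : W.card ≤ r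
  weak : N.IsWeakPartition P
  common : commonSpace N F G P ≠ ⊥
  D_eq : N.D B = N.J C
  subset : W ⊆ C ∪ B
  sources : N.D W ⊆ N.unionI P ∪ N.J C

/-- The numbers `(|C| - |W|) / t_{C,f,g}` over all valid pairs. -/
def pairBounds (N : Network 𝒱 ℰ S) (F : Matrix S ι K) (G : Matrix S κ K) (r : ℕ) : Set ℝ :=
  {y | ∃ (C W : Finset ℰ) (P : Finpartition C), ValidPair N F G r C W P ∧
    y = ((C.card : ℝ) - (W.card : ℝ)) / (tDim N F G P : ℝ)}

/-- The numbers `(|C ∪ B| - |W|) / t_{C,f,g}` over all valid triples. -/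
def tripleBounds (N : Network 𝒱 ℰ S) (F : Matrix S ι K) (G : Matrix S κ K) (r : ℕ) : Set ℝ :=
  {y | ∃ (C B W : Finset ℰ) (P : Finpartition C), ValidTriple N F G r C B W P ∧
    y = (((C ∪ B).card : ℝ) - (W.card : ℝ)) / (tDim N F G P : ℝ)}

end Bounds

/-! ### Secure network codes -/

/-- Mutual information `I(X; Y)` of two functions on a finite set carrying the uniform
distribution: the Kullback–Leibler divergence of the joint law from the product of the marginal
laws. -/
noncomputable def mutualInfo {Ω : Type u} {α : Type v} {β : Type w} [Finite Ω] [Nonempty Ω]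
    (X : Ω → α) (Y : Ω → β) : ENNReal :=
  letI : Fintype Ω := Fintype.ofFinite Ω
  letI : MeasurableSpace α := ⊤
  letI : MeasurableSpace β := ⊤
  let U : PMF Ω := PMF.uniformOfFintype Ω
  InformationTheory.klDiv (U.map fun o => (X o, Y o)).toMeasure
    ((U.map X).toMeasure.prod (U.map Y).toMeasure)

section Codes

variable {𝒱 ℰ S : Type} [Finite 𝒱] [Finite ℰ] [Finite S]

/-- An `(ℓ, n)` network code with source alphabet `A`, edge alphabet `B`, output alphabet `O` and
key sets `Key i`: local encoding functions for the edges, and a decoding function. -/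
structure NetworkCode (N : Network 𝒱 ℰ S) (A : Type u) (B : Type v) (O : Type w)
    (Key : S → Type x) (ℓ n : ℕ) where
  srcEnc : ∀ (i : S) (e : ℰ), N.tail e = N.source i → (Fin ℓ → A) → Key i → (Fin n → B)
  relayEnc : ∀ e : ℰ, (¬ ∃ i, N.tail e = N.source i) →
    ({d : ℰ // N.head d = N.tail e} → Fin n → B) → (Fin n → B)
  dec : ({d : ℰ // N.head d = N.sink} → Fin n → B) → (Fin ℓ → O)

namespace NetworkCode

variable {N : Network 𝒱 ℰ S} {A : Type u} {B : Type v} {O : Type w} {Key : S → Type x}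
  {ℓ n : ℕ} (c : NetworkCode N A B O Key ℓ n)

open Classical in
/-- Global encoding functions: the message on each edge for source messages `m` and keys `k`. -/
noncomputable def globalEnc (m : S → Fin ℓ → A) (k : ∀ i, Key i) : ℰ → Fin n → B :=
  N.precedes_wellFounded.fix fun e ih =>
    if h : ∃ i, N.tail e = N.source i then
      c.srcEnc h.choose e h.choose_spec (m h.choose) (k h.choose)
    else
      c.relayEnc e h fun d => ih d.1 d.2

theorem globalEnc_source (m : S → Fin ℓ → A) (k : ∀ i, Key i) (i : S) (e : ℰ)
    (h : N.tail e = N.source i) : c.globalEnc m k e = c.srcEnc i e h (m i) (k i) := by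
  have hex : ∃ i, N.tail e = N.source i := ⟨i, h⟩
  have key : ∀ (j : S) (hj : N.tail e = N.source j),
      c.srcEnc j e hj (m j) (k j) = c.srcEnc i e h (m i) (k i) := by
    intro j hj
    obtain rfl : j = i := N.source.injective (hj.symm.trans h)
    rfl
  unfold globalEnc
  rw [WellFounded.fix_eq, dif_pos hex]
  exact key _ _

theorem globalEnc_relay (m : S → Fin ℓ → A) (k : ∀ i, Key i) (e : ℰ)
    (h : ¬ ∃ i, N.tail e = N.source i) :
    c.globalEnc m k e = c.relayEnc e h fun d => c.globalEnc m k d.1 := by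
  unfold globalEnc
  rw [WellFounded.fix_eq, dif_neg h]

/-- Admissibility for the target function `f`, security function `g` and family `𝒲` of wiretap
sets, when all source symbols and keys are independent and uniformly distributed. -/
structure Admissible {Q : Type*} [Finite A] [Nonempty A] [∀ i, Finite (Key i)]
    [∀ i, Nonempty (Key i)] (f : (S → A) → O) (g : (S → A) → Q) (𝒲 : Set (Finset ℰ)) :
    Prop where
  decodable : ∀ (m : S → Fin ℓ → A) (k : ∀ i, Key i),
    c.dec (fun d => c.globalEnc m k d.1) = fun j => f fun i => m i j
  secure : ∀ W ∈ 𝒲,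
    mutualInfo
      (fun o : (S → Fin ℓ → A) × (∀ i, Key i) => fun e : W => c.globalEnc o.1 o.2 e.1)
      (fun o : (S → Fin ℓ → A) × (∀ i, Key i) => fun j : Fin ℓ => g fun i => o.1 i j) = 0

end NetworkCode

/-- The wiretap sets of security level `r`. -/
def wiretapSets (ℰ : Type) (r : ℕ) : Set (Finset ℰ) := {W | W.card ≤ r}

/-- The secure computing rate region: the nonnegative reals `R` such that for every `ε > 0` some
admissible `(ℓ, n)` code with finite key sets has rate `ℓ / n > R - ε`. -/
def rateRegion (N : Network 𝒱 ℰ S) {A : Type u} (B : Type v) {O : Type w} {Q : Type x}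
    [Finite A] [Nonempty A] (f : (S → A) → O) (g : (S → A) → Q) (r : ℕ) : Set ℝ :=
  {R | 0 ≤ R ∧ ∀ ε : ℝ, 0 < ε → ∃ (ℓ n : ℕ) (Key : S → Type u) (_ : ∀ i, Finite (Key i))
    (_ : ∀ i, Nonempty (Key i)) (c : NetworkCode N A B O Key ℓ n),
    0 < n ∧ c.Admissible f g (wiretapSets ℰ r) ∧ R - ε < (ℓ : ℝ) / (n : ℝ)}

/-- The linear function `x ↦ x F`. -/
def linFun {K : Type u} [Field K] {ι : Type v} [Fintype S] (F : Matrix S ι K) (y : S → K) :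
    ι → K :=
  Matrix.vecMul y F

open Classical in
/-- A code over the field `K`, the key of source `i` being a vector of length `z i`, is linear if
every edge carries a linear combination of what is available at its tail. -/
def NetworkCode.IsLinear {K : Type u} [Field K] {O : Type w} {N : Network 𝒱 ℰ S} [Fintype ℰ]
    {z : S → ℕ} {ℓ n : ℕ} (c : NetworkCode N K K O (fun i => Fin (z i) → K) ℓ n) : Prop :=
  (∀ i e h, ∃ (a : Matrix (Fin ℓ) (Fin n) K) (b : Matrix (Fin (z i)) (Fin n) K),
    ∀ m k, c.srcEnc i e h m k = Matrix.vecMul m a + Matrix.vecMul k b) ∧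
  (∀ e h, ∃ T : {d : ℰ // N.head d = N.tail e} → Matrix (Fin n) (Fin n) K,
    ∀ y, c.relayEnc e h y = ∑ d, Matrix.vecMul (y d) (T d))

end Codes

/-! ### Branches -/

/-- The vertices of a branch: `V` sources, the middle node and the sink. -/
inductive BranchVertex (V : ℕ)
  | src (i : Fin V)
  | mid
  | sink
  deriving DecidableEq, Fintype

/-- The edges of a branch: `Sum.inl (i, a)` is the `a`-th edge from source `i` to the middle node,
`Sum.inr a` the `a`-th edge from the middle node to the sink. -/
abbrev BranchEdge (V α : ℕ) : Type := (Fin V × Fin α) ⊕ Fin α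

/-- Tails of the edges of a branch. -/
def branchTail {V α : ℕ} : BranchEdge V α → BranchVertex V
  | Sum.inl e => BranchVertex.src e.1
  | Sum.inr _ => BranchVertex.mid

/-- Heads of the edges of a branch. -/
def branchHead {V α : ℕ} : BranchEdge V α → BranchVertex V
  | Sum.inl _ => BranchVertex.mid
  | Sum.inr _ => BranchVertex.sink

/-- The layer of a vertex of a branch. -/
def branchLayer {V : ℕ} : BranchVertex V → ℕ
  | BranchVertex.src _ => 0
  | BranchVertex.mid => 1
  | BranchVertex.sink => 2

theorem branchLayer_lt {V α : ℕ} {a b : BranchVertex V} {p : List (BranchEdge V α)}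
    (h : IsPath branchTail branchHead a p b) : branchLayer a < branchLayer b := by
  have step : ∀ e : BranchEdge V α,
      branchLayer (branchTail e) < branchLayer (branchHead e) := by
    rintro (e | e) <;> simp [branchTail, branchHead, branchLayer]
  induction h with
  | single e => exact step e
  | cons e p b _ ih => exact (step e).trans ih

/-- The branch with `V` sources, one middle node, one sink and `α ≥ 1` parallel edges per link. -/
def branch (V α : ℕ) (hα : 0 < α) : Network (BranchVertex V) (BranchEdge V α) (Fin V) where
  tail := branchTail
  head := branchHead
  source := ⟨BranchVertex.src, fun i j h => by injection h⟩
  sink := BranchVertex.sink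
  source_ne_sink := by
    intro i h
    change BranchVertex.src i = BranchVertex.sink at h
    cases h
  acyclic := fun a p h => lt_irrefl _ (branchLayer_lt h)
  source_no_in := by
    rintro i (e | e) h
    · change BranchVertex.mid = BranchVertex.src i at h
      cases h
    · change BranchVertex.sink = BranchVertex.src i at h
      cases h
  path_to_sink := by
    have hm : IsPath (branchTail (V := V) (α := α)) branchHead BranchVertex.mid
        [Sum.inr (Fin.mk 0 hα)] BranchVertex.sink := IsPath.single (Sum.inr (Fin.mk 0 hα))
    intro a h
    cases a with
    | src i =>
      refine ⟨[Sum.inl (i, Fin.mk 0 hα), Sum.inr (Fin.mk 0 hα)], ?_⟩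
      exact IsPath.cons (Sum.inl (i, Fin.mk 0 hα)) _ _ hm
    | mid => exact ⟨_, hm⟩
    | sink => exact absurd rfl h

end SecureComputation

/-!
The secure computing capacity of a branch has a closed form: with `d = dim (⟨F⟩ ∩ ⟨G⟩)` it is
`min (α / rank F) (max (α - r) 0 / d)`.

*Bounds.* The cut formed by the `α` edges into the sink, with its trivial partition, gives the value
`max (α - r) 0 / d` in both families of bounds, and no other cut gives less
(`sub_mul_tDim_le`, `isLeast_bounds`). Indeed, let `A` be the set of sources all of whose edges lie
in a common part. If no part contains all middle edges, then `|C| ≥ α |A|` and `t ≤ |A|`; if some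
part does, then `|C| ≥ α + α |A|` and `t ≤ d + |A|`, since a source can add only one dimension.

*Converse.* The middle edges determine the target, which gives `ℓ rank F ≤ n α`. By security, given
what `min r α` middle edges carry, the part of the target lying in `⟨F⟩ ∩ ⟨G⟩` may still have any
value, so that the remaining middle edges must carry it: `ℓ d ≤ n (α - r)`
(`finrank_mul_le_of_forall_exists`).

*Achievability.* Take `r < α`, and `ℓ`, `n` with `ℓ rank F ≤ α n` and `ℓ d ≤ (α - r) n`, first over
a large extension `L` of the field. Each source extends its `ℓ` message symbols by a key to a vector
of `α n` symbols; the middle node, which receives all of these, forms the `ℓ rank F` values of the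
target and fills them up with key symbols to a vector of `α n` symbols as well. Each of these
vertices sends `α n` independent combinations of its vector. On the subspace where the security
function vanishes, a source vector still has rank at least `α n - ℓ ≥ r n`, and the vector of the
middle node has rank `α n - ℓ d ≥ r n`. Hence the combinations can be chosen, one after the other,
such that the at most `r n` ones on any `r` edges remain independent on that subspace
(`exists_generic_encoding`): each requirement excludes a proper subspace, and `L` is large. By this
independence, whatever the observed edges carry can be cancelled without changing the security
function, which is independence of the two (`mutualInfo_eq_zero_of_addMonoidHom`). A linear
identification of `L` with a power of the small field gives the code.
-/

namespace SecureComputation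

/-! ### Mutual information of functions on a uniform finite set -/

section Information

open MeasureTheory InformationTheory

theorem uniform_map_apply {Ω : Type u} {γ : Type v} [Finite Ω] [Nonempty Ω] (Z : Ω → γ) (z : γ) :
    letI : Fintype Ω := Fintype.ofFinite Ω
    (PMF.uniformOfFintype Ω).map Z z = (Nat.card {o // Z o = z} : ENNReal) / Nat.card Ω := by
  classical
  let _ : Fintype Ω := Fintype.ofFinite Ω
  rw [PMF.map_apply, tsum_fintype]
  simp only [PMF.uniformOfFintype_apply, eq_comm (a := z)]
  rw [← Finset.sum_filter, Finset.sum_const, nsmul_eq_mul, div_eq_mul_inv,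
    Nat.card_eq_fintype_card, Nat.card_eq_fintype_card, Fintype.card_subtype]

/-- Mutual information vanishes exactly when the two functions are independent, which on a
uniform finite space is an identity between numbers of outcomes. -/
theorem mutualInfo_eq_zero_iff {Ω : Type u} {α : Type v} {β : Type w} [Finite Ω] [Nonempty Ω]
    [Finite α] [Finite β] (X : Ω → α) (Y : Ω → β) :
    mutualInfo X Y = 0 ↔ ∀ x y, Nat.card {o // X o = x ∧ Y o = y} * Nat.card Ω =
      Nat.card {o // X o = x} * Nat.card {o // Y o = y} := by
  classical
  let _ : Fintype Ω := Fintype.ofFinite Ω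
  let _ : MeasurableSpace α := ⊤
  let _ : MeasurableSpace β := ⊤
  have hcard : (Nat.card Ω : ENNReal) ≠ 0 := by
    exact_mod_cast Nat.card_pos.ne'
  have hcard' : (Nat.card Ω : ENNReal) ≠ ⊤ := ENNReal.natCast_ne_top _
  have hsingle : ∀ x y, ((PMF.uniformOfFintype Ω).map fun o => (X o, Y o)).toMeasure {(x, y)} =
      (((PMF.uniformOfFintype Ω).map X).toMeasure.prod
        ((PMF.uniformOfFintype Ω).map Y).toMeasure) {(x, y)} ↔
      Nat.card {o // X o = x ∧ Y o = y} * Nat.card Ω =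
        Nat.card {o // X o = x} * Nat.card {o // Y o = y} := by
    intro x y
    rw [← Set.singleton_prod_singleton, Measure.prod_prod, Set.singleton_prod_singleton,
      PMF.toMeasure_apply_singleton _ _ (MeasurableSet.singleton _),
      PMF.toMeasure_apply_singleton _ _ (MeasurableSet.singleton _),
      PMF.toMeasure_apply_singleton _ _ (MeasurableSet.singleton _),
      uniform_map_apply, uniform_map_apply, uniform_map_apply]
    simp only [Prod.mk.injEq]
    rw [← ENNReal.mul_div_mul_comm (Or.inl hcard) (Or.inl hcard'), ENNReal.div_eq_div_iff
      (mul_ne_zero hcard hcard) (ENNReal.mul_ne_top hcard' hcard') hcard hcard', mul_assoc,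
      ENNReal.mul_right_inj hcard hcard', mul_comm]
    norm_cast
  unfold mutualInfo
  rw [klDiv_eq_zero_iff]
  constructor
  · intro h x y
    rw [← hsingle]
    exact congrArg (fun μ => μ {(x, y)}) h
  · intro h
    refine Measure.ext_of_singleton fun z => ?_
    exact (hsingle z.1 z.2).2 (h z.1 z.2)

/-- If `X` and `Y` are independent, every value of `X` occurs together with every value of `Y`. -/
theorem exists_of_mutualInfo_eq_zero {Ω : Type u} {α : Type v} {β : Type w} [Finite Ω]
    [Nonempty Ω] [Finite α] [Finite β] {X : Ω → α} {Y : Ω → β} (h : mutualInfo X Y = 0)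
    (o₁ o₂ : Ω) : ∃ o, X o = X o₁ ∧ Y o = Y o₂ := by
  have h' := (mutualInfo_eq_zero_iff X Y).1 h (X o₁) (Y o₂)
  have h₁ : 0 < Nat.card {o // X o = X o₁} := Nat.card_pos_iff.2 ⟨⟨o₁, rfl⟩, inferInstance⟩
  have h₂ : 0 < Nat.card {o // Y o = Y o₂} := Nat.card_pos_iff.2 ⟨⟨o₂, rfl⟩, inferInstance⟩
  have h₃ : 0 < Nat.card {o // X o = X o₁ ∧ Y o = Y o₂} :=
    Nat.pos_of_mul_pos_right (h' ▸ Nat.mul_pos h₁ h₂)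
  obtain ⟨⟨o, ho⟩⟩ := (Nat.card_pos_iff.1 h₃).1
  exact ⟨o, ho⟩

/-- Additive functions `X`, `Y` such that `Y` takes all its values on the kernel of `X` are
independent: splitting `o₂ - o₁` into elements of the two kernels turns a pair with `X o₁ = x`,
`Y o₂ = y` into one outcome with both values together with an arbitrary difference. -/
theorem mutualInfo_eq_zero_of_addMonoidHom {Ω : Type u} {α : Type v} {β : Type w}
    [AddCommGroup Ω] [AddCommGroup α] [AddCommGroup β] [Finite Ω] [Finite α] [Finite β]
    (X : Ω →+ α) (Y : Ω →+ β) (h : ∀ o, ∃ o', X o' = 0 ∧ Y o' = Y o) :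
    mutualInfo X Y = 0 := by
  rw [mutualInfo_eq_zero_iff]
  intro x y
  choose s hsX hsY using h
  rw [← Nat.card_prod, ← Nat.card_prod]
  refine Nat.card_congr
    { toFun := fun p => (⟨p.1.1 - s p.2, ?_⟩, ⟨p.1.1 - s p.2 + p.2, ?_⟩)
      invFun := fun p => (⟨p.1.1 + s (p.2.1 - p.1.1), ?_, ?_⟩, p.2.1 - p.1.1)
      left_inv := ?_
      right_inv := ?_ }
  · rw [map_sub, hsX, sub_zero, p.1.2.1]
  · rw [map_add, map_sub, hsY, sub_add_cancel, p.1.2.2]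
  · rw [map_add, hsX, add_zero, p.1.2]
  · rw [map_add, hsY, map_sub, p.2.2]; abel
  · rintro ⟨⟨o, ho⟩, d⟩
    simp
  · rintro ⟨⟨o, ho⟩, ⟨o', ho'⟩⟩
    simp

end Information

/-! ### Linear codes from linear global encodings -/

section LinearCodes

variable {𝒱 ℰ S : Type} [Finite 𝒱] [Finite S]

theorem exists_matrix_of_linearMap {K : Type u} [Field K] {ι κ : Type*} [Fintype ι] [DecidableEq ι]
    (f : (ι → K) →ₗ[K] (κ → K)) : ∃ a : Matrix ι κ K, ∀ m, f m = Matrix.vecMul m a := by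
  refine ⟨Matrix.of fun i => f (Pi.single i 1), fun m => ?_⟩
  ext j
  conv_lhs => rw [← Finset.univ_sum_single m, map_sum, Finset.sum_apply]
  refine Finset.sum_congr rfl fun i _ => ?_
  rw [show Pi.single i (m i) = m i • Pi.single i (1 : K) by
    rw [← Pi.single_smul', smul_eq_mul, mul_one], map_smul]
  rfl

/-- A linear map factors through a second one as soon as its kernel contains that of the second. -/
theorem exists_linearMap_comp_eq {K : Type u} [Field K] {Ω P Q : Type*} [AddCommGroup Ω]
    [Module K Ω] [AddCommGroup P] [Module K P] [AddCommGroup Q] [Module K Q]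
    (R : Ω →ₗ[K] P) (B : Ω →ₗ[K] Q) (h : ∀ ω, R ω = 0 → B ω = 0) :
    ∃ T : P →ₗ[K] Q, ∀ ω, T (R ω) = B ω := by
  obtain ⟨g, hg⟩ := R.rangeRestrict.exists_rightInverse_of_surjective R.range_rangeRestrict
  obtain ⟨T, hT⟩ := LinearMap.exists_extend (B ∘ₗ g)
  refine ⟨T, fun ω => ?_⟩
  have h1 : T (R ω) = B (g (R.rangeRestrict ω)) :=
    LinearMap.congr_fun hT (R.rangeRestrict ω)
  have h2 : R (g (R.rangeRestrict ω)) = R ω :=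
    congrArg Subtype.val (LinearMap.congr_fun hg (R.rangeRestrict ω))
  rw [h1, ← sub_eq_zero, ← map_sub]
  exact h _ (by rw [map_sub, h2, sub_self])

/-- Prescribed linear global encodings are realized by a linear code, provided that the encoding
of an edge leaving a source depends only on that source, that the encoding of any other edge is
determined (vanishing being enough, by linearity) by the edges entering its tail, and that the
edges entering the sink determine the target. -/
theorem exists_linear_code {K : Type u} [Field K] [Fintype ℰ] (N : Network 𝒱 ℰ S)
    {O : Type w} [Nonempty O] {ℓ n : ℕ} {z : S → ℕ} (f : (S → K) → O)
    (Y : ℰ → ((S → Fin ℓ → K) × (∀ i, Fin (z i) → K)) →ₗ[K] (Fin n → K))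
    (hsrc : ∀ i e, N.tail e = N.source i →
      ∃ A : ((Fin ℓ → K) × (Fin (z i) → K)) →ₗ[K] (Fin n → K),
        ∀ m k, Y e (m, k) = A (m i, k i))
    (hrel : ∀ e, (¬ ∃ i, N.tail e = N.source i) →
      ∀ ω, (∀ d, N.head d = N.tail e → Y d ω = 0) → Y e ω = 0)
    (hdec : ∀ ω ω', (∀ d, N.head d = N.sink → Y d ω = Y d ω') →
      ∀ j, f (fun i => ω.1 i j) = f (fun i => ω'.1 i j)) :
    ∃ c : NetworkCode N K K O (fun i => Fin (z i) → K) ℓ n, c.IsLinear ∧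
      (∀ m k e, c.globalEnc m k e = Y e (m, k)) ∧
      ∀ m k, c.dec (fun d => c.globalEnc m k d.1) = fun j => f fun i => m i j := by
  classical
  choose A hA using hsrc
  have hT : ∀ e, (¬ ∃ i, N.tail e = N.source i) →
      ∃ T : ({d : ℰ // N.head d = N.tail e} → Fin n → K) →ₗ[K] (Fin n → K),
        ∀ ω, T (fun d => Y d.1 ω) = Y e ω := fun e he =>
    exists_linearMap_comp_eq (LinearMap.pi fun d : {d : ℰ // N.head d = N.tail e} => Y d.1) (Y e)
      fun ω hω => hrel e he ω fun d hd => congrFun hω ⟨d, hd⟩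
  choose T hT using hT
  let c : NetworkCode N K K O (fun i => Fin (z i) → K) ℓ n :=
    -- The decoder looks for any input producing what it receives; all of them share the target.
    { srcEnc := fun i e h m k => A i e h (m, k)
      relayEnc := fun e h y => T e h y
      dec := fun y j =>
        if h : ∃ ω, (fun d : {d : ℰ // N.head d = N.sink} => Y d.1 ω) = y then
          f fun i => h.choose.1 i j
        else Classical.arbitrary O }
  have henc : ∀ m k e, c.globalEnc m k e = Y e (m, k) := by
    intro m k e
    induction e using N.precedes_wellFounded.induction with
    | _ e ih =>
      by_cases h : ∃ i, N.tail e = N.source i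
      · obtain ⟨i, hi⟩ := h
        rw [c.globalEnc_source m k i e hi, hA i e hi]
      · rw [c.globalEnc_relay m k e h, ← hT e h (m, k)]
        exact congrArg (T e h) (funext fun d => ih d.1 d.2)
  refine ⟨c, ⟨fun i e h => ?_, fun e h => ?_⟩, henc, fun m k => ?_⟩
  · obtain ⟨a, ha⟩ := exists_matrix_of_linearMap (A i e h ∘ₗ LinearMap.inl K _ _)
    obtain ⟨b, hb⟩ := exists_matrix_of_linearMap (A i e h ∘ₗ LinearMap.inr K _ _)
    refine ⟨a, b, fun m k => ?_⟩
    rw [← ha, ← hb, LinearMap.comp_apply, LinearMap.comp_apply, ← map_add]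
    simp [c]
  · choose M hM using fun d => exists_matrix_of_linearMap
      (T e h ∘ₗ LinearMap.single K (fun _ : {d : ℰ // N.head d = N.tail e} => Fin n → K) d)
    refine ⟨M, fun y => ?_⟩
    simp only [← hM, LinearMap.comp_apply, ← map_sum]
    exact congrArg (T e h) (Finset.univ_sum_single y).symm
  · funext j
    have hex : ∃ ω, (fun d : {d : ℰ // N.head d = N.sink} => Y d.1 ω) =
        fun d => c.globalEnc m k d.1 := ⟨(m, k), funext fun d => (henc m k d.1).symm⟩
    have hdec' : c.dec (fun d => c.globalEnc m k d.1) j = f fun i => hex.choose.1 i j :=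
      dif_pos hex
    rw [hdec']
    refine hdec _ (m, k) (fun d hd => ?_) j
    rw [← henc m k d]
    exact congrFun hex.choose_spec ⟨d, hd⟩

end LinearCodes

/-! ### Cuts of a branch -/

section BranchCuts

variable {V α : ℕ} (hα : 0 < α)

/-- The edges from the middle node of a branch to its sink. -/
def midEdges (V α : ℕ) : Finset (BranchEdge V α) :=
  Finset.univ.map Function.Embedding.inr

/-- All edges leaving one of the sources in `A`. -/
def outEdges {V : ℕ} (α : ℕ) (A : Finset (Fin V)) : Finset (BranchEdge V α) :=
  (A ×ˢ Finset.univ).map Function.Embedding.inl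

theorem mem_midEdges {e : BranchEdge V α} : e ∈ midEdges V α ↔ ∃ c, Sum.inr c = e := by
  simp [midEdges]

theorem card_midEdges : (midEdges V α).card = α := by
  simp [midEdges]

theorem card_outEdges (A : Finset (Fin V)) : (outEdges α A).card = α * A.card := by
  simp [outEdges, mul_comm]

theorem exists_mem_midEdges {a b : BranchVertex V} {p : List (BranchEdge V α)}
    (h : IsPath branchTail branchHead a p b) (hb : b = BranchVertex.sink) :
    ∃ e ∈ p, e ∈ midEdges V α := by
  induction h with
  | single e =>
    cases e with
    | inl e => cases hb
    | inr c => exact ⟨_, List.mem_singleton_self _, mem_midEdges.2 ⟨c, rfl⟩⟩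
  | cons e p b _ ih =>
    obtain ⟨e', he', hm⟩ := ih hb
    exact ⟨e', List.mem_cons_of_mem _ he', hm⟩

theorem I_eq_univ {C : Finset (BranchEdge V α)} (h : midEdges V α ⊆ C) :
    (branch V α hα).I C = Set.univ := by
  refine Set.eq_univ_of_forall fun i => ?_
  rintro ⟨p, hp, hC⟩
  obtain ⟨e, he, hm⟩ := exists_mem_midEdges hp rfl
  exact hC e he (h hm)

theorem inl_mem_of_mem_I {C : Finset (BranchEdge V α)} (h : ¬ midEdges V α ⊆ C) {i : Fin V}
    (hi : i ∈ (branch V α hα).I C) (c : Fin α) : Sum.inl (i, c) ∈ C := by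
  by_contra hc
  obtain ⟨e, he, heC⟩ := Finset.not_subset.1 h
  obtain ⟨d, rfl⟩ := mem_midEdges.1 he
  refine hi ⟨[Sum.inl (i, c), Sum.inr d], IsPath.cons (Sum.inl (i, c)) _ _
    (IsPath.single (tail := branchTail (V := V)) (head := branchHead) (Sum.inr d)), ?_⟩
  simp [hc, heC]

end BranchCuts

/-! ### Dimensions of column spaces -/

section ColumnSpaces

variable {K : Type u} [Field K] {S : Type} {ι : Type v}

/-- The vectors supported on `A`. -/
noncomputable def coordSpan (K : Type u) [Field K] [DecidableEq S] (A : Finset S) :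
    Submodule K (S → K) :=
  Submodule.span K (Set.range fun i : A => Pi.single i.1 (1 : K))

theorem finrank_coordSpan_le [DecidableEq S] (A : Finset S) :
    Module.finrank K (coordSpan K A) ≤ A.card :=
  (finrank_range_le_card _).trans (Fintype.card_coe A).le

theorem colSpan_restrictRows_le [Fintype S] [DecidableEq S] (F : Matrix S ι K) {X : Set S} {A : Finset S}
    (h : X ⊆ A) : colSpan (restrictRows F X) ≤ coordSpan K A := by
  classical
  refine Submodule.span_le.2 ?_
  rintro _ ⟨j, rfl⟩
  change (fun i => restrictRows F X i j) ∈ coordSpan K A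
  rw [← Finset.univ_sum_single fun i => restrictRows F X i j]
  refine Submodule.sum_mem _ fun i _ => ?_
  by_cases hi : i ∈ X
  · rw [show Pi.single i (restrictRows F X i j) =
      restrictRows F X i j • (Pi.single i (1 : K) : S → K) by
        rw [← Pi.single_smul', smul_eq_mul, mul_one]]
    exact Submodule.smul_mem _ _ (Submodule.subset_span
      ⟨⟨i, h hi⟩, rfl⟩)
  · simp [restrictRows, hi]

theorem restrictRows_univ (F : Matrix S ι K) : restrictRows F Set.univ = F := by
  ext i j
  simp [restrictRows]

theorem finrank_sup_inf_le [Finite S] (P Q R : Submodule K (S → K)) :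
    Module.finrank K ((P ⊔ Q) ⊓ R : Submodule K (S → K)) ≤
      Module.finrank K (P ⊓ R : Submodule K (S → K)) + Module.finrank K Q := by
  have h1 := Submodule.finrank_sup_add_finrank_inf_eq ((P ⊔ Q) ⊓ R) P
  have h2 : (P ⊔ Q) ⊓ R ⊓ P = P ⊓ R := by
    rw [inf_right_comm, inf_comm (P ⊔ Q) P, inf_sup_self]
  have h3 : Module.finrank K ((P ⊔ Q) ⊓ R ⊔ P : Submodule K (S → K)) ≤
      Module.finrank K (P ⊔ Q : Submodule K (S → K)) :=
    Submodule.finrank_mono (sup_le inf_le_left le_sup_left)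
  have h4 := Submodule.finrank_add_le_finrank_add_finrank P Q
  rw [h2] at h1
  omega

end ColumnSpaces

/-! ### The least bounds of a branch -/

section BranchBounds

variable {V α : ℕ} (hα : 0 < α) {K : Type u} [Field K] {ι : Type v} {κ : Type w}
  (F : Matrix (Fin V) ι K) (G : Matrix (Fin V) κ K)

/-- No cut beats the middle edges. With `A` the sources all of whose edges lie in one part, a cut
without all the middle edges has at least `α |A|` edges and `t ≤ |A|`, and one with them has at
least `α + α |A|` edges and `t ≤ t₀ + |A|`, where `t₀` is the value of `t` for the middle edges. -/
theorem sub_mul_tDim_le (r : ℕ) {C : Finset (BranchEdge V α)} (P : Finpartition C)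
    (hFG : colSpan F ⊓ colSpan G ≠ ⊥) (hP : commonSpace (branch V α hα) F G P ≠ ⊥) :
    (α - r) * tDim (branch V α hα) F G P ≤
      (C.card - r) * Module.finrank K (colSpan F ⊓ colSpan G : Submodule K (Fin V → K)) := by
  classical
  obtain hr | hr := le_total α r
  · rw [Nat.sub_eq_zero_of_le hr, zero_mul]
    exact Nat.zero_le _
  set N := branch V α hα
  set t₀ := Module.finrank K (colSpan F ⊓ colSpan G : Submodule K (Fin V → K)) with ht₀
  set t := tDim N F G P with ht
  have ht₀pos : 1 ≤ t₀ := Nat.one_le_iff_ne_zero.2 fun h => hFG (Submodule.finrank_eq_zero.1 h)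
  have htpos : 1 ≤ t := Nat.one_le_iff_ne_zero.2 fun h => hP (Submodule.finrank_eq_zero.1 h)
  set A : Finset (Fin V) :=
    Finset.univ.filter fun i => ∃ X ∈ P.parts, ¬ midEdges V α ⊆ X ∧ i ∈ N.I X with hA
  have hAC : outEdges α A ⊆ C := by
    intro e he
    obtain ⟨⟨i, c⟩, hic, rfl⟩ := Finset.mem_map.1 he
    obtain ⟨X, hX, hm, hi⟩ := (Finset.mem_filter.1 (Finset.mem_product.1 hic).1).2
    exact P.le hX (inl_mem_of_mem_I hα hm hi c)
  have hpart : ∀ X ∈ P.parts, ¬ midEdges V α ⊆ X →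
      colSpan (restrictRows F (N.I X)) ≤ coordSpan K A := fun X hX hm =>
    colSpan_restrictRows_le F fun i hi =>
      Finset.mem_coe.2 (Finset.mem_filter.2 ⟨Finset.mem_univ _, X, hX, hm, hi⟩)
  by_cases hmid : ∃ X ∈ P.parts, midEdges V α ⊆ X
  · obtain ⟨X₀, hX₀, hmX₀⟩ := hmid
    have hcard : α + α * A.card ≤ C.card := by
      rw [← card_outEdges (α := α) A]
      nth_rw 1 [← card_midEdges (V := V) (α := α)]
      rw [← Finset.card_union_of_disjoint]
      · exact Finset.card_le_card (Finset.union_subset (hmX₀.trans (P.le hX₀)) hAC)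
      · rw [Finset.disjoint_left]
        intro e he he'
        obtain ⟨c, rfl⟩ := mem_midEdges.1 he
        simp [outEdges] at he'
    have htle : t ≤ t₀ + A.card := by
      have hle : commonSpace N F G P ≤ (colSpan F ⊔ coordSpan K A) ⊓ colSpan G := by
        refine inf_le_inf_right _ (iSup₂_le fun X hX => ?_)
        by_cases hm : midEdges V α ⊆ X
        · rw [I_eq_univ hα hm, restrictRows_univ]
          exact le_sup_left
        · exact (hpart X hX hm).trans le_sup_right
      calc t ≤ _ := Submodule.finrank_mono hle
        _ ≤ _ := finrank_sup_inf_le _ _ _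
        _ ≤ _ := Nat.add_le_add_left (finrank_coordSpan_le A) _
    calc (α - r) * t ≤ (α - r) * (t₀ + A.card) := Nat.mul_le_mul_left _ htle
      _ = (α - r) * t₀ + (α - r) * A.card := mul_add _ _ _
      _ ≤ (α - r) * t₀ + (α * A.card) * t₀ := by
        refine Nat.add_le_add_left ?_ _
        exact (Nat.mul_le_mul_right _ (Nat.sub_le α r)).trans (Nat.le_mul_of_pos_right _ ht₀pos)
      _ = (α - r + α * A.card) * t₀ := (add_mul _ _ _).symm
      _ ≤ (C.card - r) * t₀ := by
        exact Nat.mul_le_mul_right _ (by omega)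
  · push Not at hmid
    have htle : t ≤ A.card := by
      have hle : commonSpace N F G P ≤ coordSpan K A :=
        inf_le_left.trans (iSup₂_le fun X hX => hpart X hX (hmid X hX))
      exact (Submodule.finrank_mono hle).trans (finrank_coordSpan_le A)
    have hcard : α * t ≤ C.card := by
      refine (Nat.mul_le_mul_left α htle).trans ?_
      rw [← card_outEdges (α := α) A]
      exact Finset.card_le_card hAC
    calc (α - r) * t = α * t - r * t := Nat.sub_mul _ _ _
      _ ≤ C.card - r := tsub_le_tsub hcard (Nat.le_mul_of_pos_right _ htpos)
      _ ≤ (C.card - r) * t₀ := Nat.le_mul_of_pos_right _ ht₀pos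

theorem div_le_div_tDim (r : ℕ) {C D W : Finset (BranchEdge V α)} (P : Finpartition C)
    (hFG : colSpan F ⊓ colSpan G ≠ ⊥) (hP : commonSpace (branch V α hα) F G P ≠ ⊥)
    (hCD : C ⊆ D) (hWD : W ⊆ D) (hW : W.card ≤ r) :
    ((α - r : ℕ) : ℝ) / (Module.finrank K (colSpan F ⊓ colSpan G : Submodule K (Fin V → K)) : ℝ) ≤
      ((D.card : ℝ) - (W.card : ℝ)) / (tDim (branch V α hα) F G P : ℝ) := by
  have h0 : 0 < Module.finrank K (colSpan F ⊓ colSpan G : Submodule K (Fin V → K)) :=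
    Nat.pos_of_ne_zero fun h => hFG (Submodule.finrank_eq_zero.1 h)
  have h1 : 0 < tDim (branch V α hα) F G P :=
    Nat.pos_of_ne_zero fun h => hP (Submodule.finrank_eq_zero.1 h)
  rw [div_le_div_iff₀ (by exact_mod_cast h0) (by exact_mod_cast h1),
    ← Nat.cast_sub (Finset.card_le_card hWD)]
  have h2 := sub_mul_tDim_le hα F G r P hFG hP
  have h3 : C.card - r ≤ D.card - W.card := tsub_le_tsub (Finset.card_le_card hCD) hW
  exact_mod_cast h2.trans (Nat.mul_le_mul_right _ h3)

/-- Both families of bounds have the least element `max (α - r, 0) / dim (⟨F⟩ ∩ ⟨G⟩)`, attained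
by the cut of all middle edges, partitioned trivially. -/
theorem isLeast_bounds (r : ℕ) (hFG : colSpan F ⊓ colSpan G ≠ ⊥) :
    IsLeast (pairBounds (branch V α hα) F G r) (((α - r : ℕ) : ℝ) /
      (Module.finrank K (colSpan F ⊓ colSpan G : Submodule K (Fin V → K)) : ℝ)) ∧
    IsLeast (tripleBounds (branch V α hα) F G r) (((α - r : ℕ) : ℝ) /
      (Module.finrank K (colSpan F ⊓ colSpan G : Submodule K (Fin V → K)) : ℝ)) := by
  obtain ⟨W, hWM, hWcard⟩ := Finset.exists_subset_card_eq (s := midEdges V α) (n := min r α)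
    (by rw [card_midEdges]; exact min_le_right _ _)
  have hI : (branch V α hα).I (midEdges V α) = Set.univ := I_eq_univ hα subset_rfl
  have hJ : (branch V α hα).J (midEdges V α) = ∅ := by rw [Network.J, hI, Set.sdiff_univ]
  have hne : midEdges V α ≠ ∅ := by
    rw [← Finset.card_pos.trans Finset.nonempty_iff_ne_empty, card_midEdges]; exact hα
  have hV : Nonempty (Fin V) := by
    by_contra h
    rw [not_nonempty_iff] at h
    exact hFG (Subsingleton.elim _ _)
  let P : Finpartition (midEdges V α) := Finpartition.indiscrete hne
  have hunion : (branch V α hα).unionI P = Set.univ := by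
    simp [Network.unionI, P, hI]
  have hcommon : commonSpace (branch V α hα) F G P = colSpan F ⊓ colSpan G := by
    simp [commonSpace, P, hI, restrictRows_univ]
  have hcut : (branch V α hα).IsCut (midEdges V α) :=
    ⟨Classical.arbitrary _, fun p hp => exists_mem_midEdges hp rfl⟩
  have hweak : (branch V α hα).IsWeakPartition P := by
    intro X hX
    obtain rfl : X = midEdges V α := by simpa [P] using hX
    rw [hI]
    simp
  have hval : ((α - r : ℕ) : ℝ) /
      (Module.finrank K (colSpan F ⊓ colSpan G : Submodule K (Fin V → K)) : ℝ) =
      (((midEdges V α).card : ℝ) - (W.card : ℝ)) / (tDim (branch V α hα) F G P : ℝ) := by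
    rw [tDim, hcommon, card_midEdges, hWcard, ← Nat.cast_sub (min_le_right _ _)]
    congr 2
    omega
  refine ⟨⟨⟨_, W, P, ⟨hcut, ?_, hweak, ?_, hWM, ?_⟩, hval⟩, ?_⟩,
    ⟨⟨_, ∅, W, P, ⟨hcut, ?_, ?_, hweak, ?_, ?_, ?_, ?_⟩, ?_⟩, ?_⟩⟩
  · rw [hWcard]; exact min_le_left _ _
  · rwa [hcommon]
  · rw [hunion]; exact Set.subset_univ _
  · rintro _ ⟨C, W, P, h, rfl⟩
    exact div_le_div_tDim hα F G r P hFG h.common subset_rfl h.subset h.card_le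
  · intro i hi
    rw [hJ] at hi
    exact hi.elim
  · rw [hWcard]; exact min_le_left _ _
  · rwa [hcommon]
  · rw [hJ]
    simp [Network.D]
  · rwa [Finset.union_empty]
  · rw [hunion]; exact Set.subset_union_of_subset_left (Set.subset_univ _) _
  · rw [Finset.union_empty]
    exact hval
  · rintro _ ⟨C, B, W, P, h, rfl⟩
    exact div_le_div_tDim hα F G r P hFG h.common Finset.subset_union_left h.subset h.card_le

end BranchBounds

/-! ### Left inverses of matrices -/

section Biorthogonal

/-- Linearly independent columns have a left inverse matrix. -/
theorem exists_left_inverse_of_linearIndependent {K : Type u} [Field K] {m ι : Type*} [Fintype m]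
    [DecidableEq m] [Fintype ι] [DecidableEq ι] (U : Matrix m ι K)
    (h : LinearIndependent K fun k i => U i k) : ∃ Q : Matrix ι m K, Q * U = 1 := by
  obtain ⟨g, hg⟩ := (Matrix.mulVecLin U).exists_leftInverse_of_injective
    (LinearMap.ker_eq_bot.2 (Matrix.mulVec_injective_iff.2 h))
  refine ⟨LinearMap.toMatrix' g, ?_⟩
  have h1 : LinearMap.toMatrix' (g ∘ₗ Matrix.mulVecLin U) = 1 := by
    rw [hg, LinearMap.toMatrix'_id]
  rwa [LinearMap.toMatrix'_comp, ← Matrix.toLin'_apply', LinearMap.toMatrix'_toLin'] at h1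

end Biorthogonal

/-! ### Converse -/

section Converse

open Matrix

variable {K : Type u} [Field K] {V : ℕ} {ι : Type w}

theorem dotProduct_eq_of_mem_colSpan {F : Matrix (Fin V) ι K} {x y : Fin V → K}
    (h : linFun F x = linFun F y) {c : Fin V → K} (hc : c ∈ colSpan F) :
    x ⬝ᵥ c = y ⬝ᵥ c := by
  induction hc using Submodule.span_induction with
  | mem c hc =>
    obtain ⟨j, rfl⟩ := hc
    exact congrFun h j
  | zero => simp
  | add c d _ _ hc hd => rw [dotProduct_add, dotProduct_add, hc, hd]
  | smul k c _ hc => rw [dotProduct_smul, dotProduct_smul, hc]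

variable [Finite K] {α : ℕ} {hα : 0 < α} {Key : Fin V → Type x} {ℓ n : ℕ}

/-- Given the messages `y` on the set `W` of middle edges, suppose the products of the source
symbols with the vectors of `H ≤ ⟨F⟩` may still take all values. The sink determines these
products, so the other middle edges must carry them. -/
theorem finrank_mul_le_of_forall_exists {F : Matrix (Fin V) ι K}
    (c : NetworkCode (branch V α hα) K K (ι → K) Key ℓ n)
    (hdec : ∀ (m : Fin V → Fin ℓ → K) (k : ∀ i, Key i),
      c.dec (fun d => c.globalEnc m k d.1) = fun j => linFun F fun i => m i j)
    {H : Submodule K (Fin V → K)} (hH : H ≤ colSpan F) {W : Finset (BranchEdge V α)}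
    (hW : W ⊆ midEdges V α) (y : BranchEdge V α → Fin n → K)
    (hy : ∀ m : Fin V → Fin ℓ → K, ∃ (m' : Fin V → Fin ℓ → K) (k' : ∀ i, Key i),
      (∀ e ∈ W, c.globalEnc m' k' e = y e) ∧
        ∀ h ∈ H, ∀ j, (fun i => m' i j) ⬝ᵥ h = (fun i => m i j) ⬝ᵥ h) :
    Module.finrank K H * ℓ ≤ n * (α - W.card) := by
  classical
  let b := Module.finBasis K H
  let U : Matrix (Fin V) (Fin (Module.finrank K H)) K := Matrix.of fun i k => (b k).1 i
  obtain ⟨Q, hQ⟩ := exists_left_inverse_of_linearIndependent U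
    (b.linearIndependent.map' H.subtype H.ker_subtype)
  choose M κ hMW hMH using hy
  -- Source symbols whose products with the basis vectors `b k` are prescribed.
  let s : (Fin ℓ → Fin (Module.finrank K H) → K) → Fin V → Fin ℓ → K :=
    fun d i j => (d j ᵥ* Q) i
  have hs : ∀ d j k, (fun i => s d i j) ⬝ᵥ (b k).1 = d j k := fun d j k => by
    change ((d j ᵥ* Q) ᵥ* U) k = d j k
    rw [vecMul_vecMul, hQ, vecMul_one]
  have hinj : Function.Injective fun (d : Fin ℓ → Fin (Module.finrank K H) → K)
      (e : (midEdges V α \ W : Finset _)) => c.globalEnc (M (s d)) (κ (s d)) e.1 := by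
    intro d d' hdd
    have hmid : ∀ e ∈ midEdges V α,
        c.globalEnc (M (s d)) (κ (s d)) e = c.globalEnc (M (s d')) (κ (s d')) e := by
      intro e he
      by_cases heW : e ∈ W
      · rw [hMW _ e heW, hMW _ e heW]
      · exact congrFun hdd ⟨e, Finset.mem_sdiff.2 ⟨he, heW⟩⟩
    have hf := hdec (M (s d)) (κ (s d))
    rw [show (fun e : {e // (branch V α hα).head e = (branch V α hα).sink} =>
        c.globalEnc (M (s d)) (κ (s d)) e.1) =
        fun e => c.globalEnc (M (s d')) (κ (s d')) e.1 by
      funext ⟨e, he⟩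
      cases e with
      | inl e => cases he
      | inr a => exact hmid _ (mem_midEdges.2 ⟨a, rfl⟩), hdec] at hf
    funext j k
    rw [← hs d j k, ← hs d' j k, ← hMH (s d) _ (b k).2 j, ← hMH (s d') _ (b k).2 j]
    exact (dotProduct_eq_of_mem_colSpan (congrFun hf j) (hH (b k).2)).symm
  have hcard := Nat.card_le_card_of_injective _ hinj
  have := Fintype.ofFinite K
  rw [Nat.card_eq_fintype_card, Nat.card_eq_fintype_card] at hcard
  simp only [Fintype.card_pi, Finset.prod_const, Finset.card_univ, Fintype.card_fin,
    Fintype.card_coe, ← pow_mul, Finset.card_sdiff_of_subset hW, card_midEdges] at hcard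
  exact (Nat.pow_le_pow_iff_right Fintype.one_lt_card).1 hcard

theorem rank_mul_le_of_admissible {a r : ℕ} {b : Type v} {F : Matrix (Fin V) (Fin a) K}
    {G : Matrix (Fin V) b K}
    [∀ i, Finite (Key i)] [∀ i, Nonempty (Key i)]
    (c : NetworkCode (branch V α hα) K K (Fin a → K) Key ℓ n)
    (hc : c.Admissible (linFun F) (linFun G) (wiretapSets _ r)) :
    F.rank * ℓ ≤ n * α := by
  rw [Matrix.rank_eq_finrank_span_cols]
  refine finrank_mul_le_of_forall_exists (H := colSpan F) c hc.decodable le_rfl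
    (Finset.empty_subset _) 0 fun m => ⟨m, fun i => Classical.arbitrary _, ?_, fun _ _ _ => rfl⟩
  simp

/-- Observing `min r α` middle edges leaves the part of the target in `⟨F⟩ ∩ ⟨G⟩` undetermined,
so the remaining middle edges carry it. -/
theorem finrank_inf_mul_le_of_admissible {r : ℕ} {b : Type v} [Finite b] {F : Matrix (Fin V) ι K}
    {G : Matrix (Fin V) b K}
    [∀ i, Finite (Key i)] [∀ i, Nonempty (Key i)]
    (c : NetworkCode (branch V α hα) K K (ι → K) Key ℓ n)
    (hc : c.Admissible (linFun F) (linFun G) (wiretapSets _ r)) :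
    Module.finrank K (colSpan F ⊓ colSpan G : Submodule K (Fin V → K)) * ℓ ≤ n * (α - r) := by
  obtain ⟨W, hWM, hWcard⟩ := Finset.exists_subset_card_eq (s := midEdges V α) (n := min r α)
    (by rw [card_midEdges]; exact min_le_right _ _)
  have hWr : W ∈ wiretapSets (BranchEdge V α) r := by
    change W.card ≤ r
    rw [hWcard]
    exact min_le_left _ _
  have hα' : α - W.card = α - r := by omega
  rw [← hα']
  have k₀ : ∀ i, Key i := fun i => Classical.arbitrary _
  refine finrank_mul_le_of_forall_exists c hc.decodable inf_le_left hWM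
    (c.globalEnc 0 k₀) fun m => ?_
  obtain ⟨o, ho1, ho2⟩ := exists_of_mutualInfo_eq_zero (hc.secure W hWr) (0, k₀) (m, k₀)
  exact ⟨o.1, o.2, fun e he => congrFun ho1 ⟨e, he⟩, fun h hh j =>
    dotProduct_eq_of_mem_colSpan (congrFun ho2 j) hh.2⟩

end Converse

/-! ### Generic linear encodings over a large field -/

section GenericChoice

/-- Linearly independent functionals take arbitrary values simultaneously. -/
theorem exists_forall_apply_eq {L : Type u} [Field L] {Ω : Type v} [AddCommGroup Ω] [Module L Ω]
    {ι : Type*} [Finite ι] {φ : ι → Module.Dual L Ω}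
    (h : LinearIndependent L φ) (y : ι → L) : ∃ u, ∀ i, φ i u = y i := by
  classical
  have := Fintype.ofFinite ι
  have hsurj : Function.Surjective (LinearMap.pi φ) := by
    rw [← LinearMap.dualMap_injective_iff, injective_iff_map_eq_zero]
    intro f hf
    have hsum : ∑ i, f (Pi.single i 1) • φ i = 0 := by
      ext u
      have hu := LinearMap.congr_fun hf u
      rw [LinearMap.dualMap_apply, ← Finset.univ_sum_single (LinearMap.pi φ u), map_sum] at hu
      rw [LinearMap.sum_apply]
      refine Eq.trans (Finset.sum_congr rfl fun i _ => ?_) hu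
      rw [show Pi.single i (LinearMap.pi φ u i) = φ i u • Pi.single i (1 : L) by
        rw [← Pi.single_smul', smul_eq_mul, mul_one]; rfl, map_smul, LinearMap.smul_apply,
        smul_eq_mul, smul_eq_mul, mul_comm]
    ext i
    simpa using Fintype.linearIndependent_iff.1 h _ hsum i
  obtain ⟨u, hu⟩ := hsurj y
  exact ⟨u, fun i => congrFun hu i⟩

variable {L : Type u} [Field L] [Finite L]

/-- Fewer than `|L|` subspaces that do not contain `U` do not cover `U`. -/
theorem exists_mem_forall_notMem {E : Type v} [AddCommGroup E] [Module L E] [Finite E]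
    {𝒞 : Type w} [Finite 𝒞] (h𝒞 : Nat.card 𝒞 < Nat.card L) (U : Submodule L E)
    (p : 𝒞 → Submodule L E) (hp : ∀ c, ¬ U ≤ p c) : ∃ v ∈ U, ∀ c, v ∉ p c := by
  classical
  have := Fintype.ofFinite 𝒞
  have := Fintype.ofFinite E
  by_contra! hcov
  have hle : Nat.card U ≤ ∑ c, Nat.card (U ⊓ p c : Submodule L E) := by
    rw [← Nat.card_sigma]
    refine Nat.card_le_card_of_surjective (fun x : Σ c, (U ⊓ p c : Submodule L E) =>
      (⟨x.2.1, x.2.2.1⟩ : U)) fun v => ?_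
    obtain ⟨c, hc⟩ := hcov v.1 v.2
    exact ⟨⟨c, v.1, v.2, hc⟩, rfl⟩
  have hpc : ∀ c, Nat.card (U ⊓ p c : Submodule L E) * Nat.card L ≤ Nat.card U := fun c => by
    have hlt : U ⊓ p c < U := lt_of_le_of_ne inf_le_left fun h => hp c (inf_eq_left.1 h)
    have hfin := Submodule.finrank_lt_finrank_of_lt hlt
    rw [Module.natCard_eq_pow_finrank (K := L) (V := U),
      Module.natCard_eq_pow_finrank (K := L) (V := (U ⊓ p c : Submodule L E)), ← pow_succ]
    exact Nat.pow_le_pow_right Nat.card_pos hfin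
  have h1 := Nat.mul_le_mul_right (Nat.card L) hle
  rw [Finset.sum_mul] at h1
  have h2 := h1.trans (Finset.sum_le_sum fun c _ => hpc c)
  rw [Finset.sum_const, smul_eq_mul, Finset.card_univ, ← Nat.card_eq_fintype_card,
    mul_comm] at h2
  exact absurd (Nat.le_of_mul_le_mul_right h2 Nat.card_pos) (not_le.2 h𝒞)

variable {Ω : Type v} [AddCommGroup Ω] [Module L Ω] [Finite Ω]

/-- Functionals can be chosen in prescribed spaces `U s` so that, for every condition `c`, those
indexed by `S c` are linearly independent on `H c`. They are chosen one after the other: each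
condition excludes a subspace, which is proper by the dimension assumption. -/
theorem exists_linearIndepOn_dualRestrict {σ : Type*} {𝒞 : Type*} [Fintype σ] [DecidableEq σ]
    [Finite 𝒞] (h𝒞 : Nat.card 𝒞 < Nat.card L) (U : σ → Submodule L (Module.Dual L Ω))
    (H : 𝒞 → Submodule L Ω) (S : 𝒞 → Finset σ)
    (hS : ∀ c, ∀ s ∈ S c, (S c).card ≤ Module.finrank L ((U s).map (H c).dualRestrict)) :
    ∃ v : σ → Module.Dual L Ω, (∀ s, v s ∈ U s) ∧
      ∀ c, LinearIndepOn L (fun s => (H c).dualRestrict (v s)) (S c) := by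
  classical
  have : Finite (Module.Dual L Ω) := Module.finite_of_finite L
  suffices h : ∀ B : Finset σ, ∃ v : σ → Module.Dual L Ω, (∀ s, v s ∈ U s) ∧
      ∀ c, LinearIndepOn L (fun s => (H c).dualRestrict (v s)) (S c ∩ B : Finset σ) by
    simpa using h Finset.univ
  intro B
  induction B using Finset.induction_on with
  | empty => exact ⟨0, fun s => (U s).zero_mem, fun c => by simp⟩
  | insert s B hsB ih =>
    obtain ⟨v, hvU, hv⟩ := ih
    -- On each `H c` with `s ∈ S c`, avoid the span of the functionals already chosen for `S c`.
    obtain ⟨x, hxU, hx⟩ := exists_mem_forall_notMem (𝒞 := {c // s ∈ S c})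
      ((Nat.card_le_card_of_injective _ Subtype.val_injective).trans_lt h𝒞) (U s)
      (fun c => (Submodule.span L ((fun t => (H c.1).dualRestrict (v t)) ''
        (S c.1 ∩ B : Finset σ))).comap (H c.1).dualRestrict) (by
      rintro ⟨c, hc⟩ hle
      have h1 := Submodule.finrank_mono (Submodule.map_le_iff_le_comap.2 hle)
      rw [← Finset.coe_image] at h1
      have h2 : (S c ∩ B).card < (S c).card :=
        Finset.card_lt_card ((Finset.ssubset_iff_of_subset Finset.inter_subset_left).2
          ⟨s, hc, fun h => hsB (Finset.mem_inter.1 h).2⟩)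
      have h3 := finrank_span_finset_le_card (R := L)
        ((S c ∩ B).image fun t => (H c).dualRestrict (v t))
      exact absurd ((hS c s hc).trans (h1.trans (h3.trans Finset.card_image_le)))
        (not_le.2 h2))
    have hne : ∀ {t}, t ∈ B → t ≠ s := fun ht h => hsB (h ▸ ht)
    refine ⟨Function.update v s x, fun t => ?_, fun c => ?_⟩
    · by_cases ht : t = s
      · subst ht
        simpa using hxU
      · simpa [ht] using hvU t
    have heq : Set.EqOn (fun t => (H c).dualRestrict (v t))
        (fun t => (H c).dualRestrict (Function.update v s x t)) (S c ∩ B : Finset σ) :=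
      fun t ht => by
        simp only [Function.update_of_ne (hne (Finset.mem_inter.1 (Finset.mem_coe.1 ht)).2)]
    have hold := (hv c).congr heq
    by_cases hc : s ∈ S c
    · rw [Finset.inter_insert_of_mem hc, Finset.coe_insert]
      refine hold.insert ?_
      rw [← heq.image_eq]
      simpa using hx ⟨c, hc⟩
    · rwa [Finset.inter_insert_of_notMem hc]

/-- Generic linear encodings. The vertex `o` has a vector `τ o ω` of `α n` symbols, which it
sends on the `α` edges `e` with `node e = o`, each carrying `n` linear combinations. If every
`τ o` keeps rank at least `r n` on the subspace `H`, the combinations can be chosen such that the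
edges from `o` together determine `τ o ω`, while what any `r` edges carry can be produced by an
element of `H`. -/
theorem exists_generic_encoding {ℰ ν : Type*} [Fintype ℰ] [DecidableEq ℰ] [Fintype ν]
    [DecidableEq ν] (node : ℰ → ν) {α n r : ℕ}
    (hnode : ∀ o, (Finset.univ.filter fun e => node e = o).card = α)
    (hL : Nat.card (Finset ℰ ⊕ ν) < Nat.card L) (H : Submodule L Ω)
    (τ : ν → Ω →ₗ[L] (Fin (α * n) → L)) (hτ : ∀ o, Function.Surjective (τ o))
    (hH : ∀ o, r * n ≤ Module.finrank L (H.map (τ o))) :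
    ∃ θ : ℰ → (Fin (α * n) → L) →ₗ[L] (Fin n → L),
      (∀ o x, (∀ e, node e = o → θ e x = 0) → x = 0) ∧
      ∀ W : Finset ℰ, W.card ≤ r → ∀ ω, ∃ u ∈ H, ∀ e ∈ W,
        θ e (τ (node e) u) = θ e (τ (node e) ω) := by
  classical
  -- The rank of the functionals factoring through `τ o`, on a subspace `H'`.
  have hrank : ∀ (H' : Submodule L Ω) o, Module.finrank L
      ((LinearMap.range (τ o).dualMap).map H'.dualRestrict) = Module.finrank L (H'.map (τ o)) := by
    intro H' o
    have h1 : (LinearMap.range (τ o).dualMap).map H'.dualRestrict =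
        LinearMap.range ((τ o) ∘ₗ H'.subtype).dualMap := by
      rw [LinearMap.dualMap_comp_dualMap .. |>.symm, LinearMap.range_comp]
      rfl
    rw [h1, LinearMap.finrank_range_dualMap_eq_finrank_range, LinearMap.range_comp,
      Submodule.range_subtype]
  -- Conditions: independence on `H` for any `r` edges, and on the whole space for each vertex.
  obtain ⟨v, hvU, hv⟩ := exists_linearIndepOn_dualRestrict (σ := ℰ × Fin n)
    (𝒞 := {W : Finset ℰ // W.card ≤ r} ⊕ ν) (Ω := Ω)
    (lt_of_le_of_lt (Nat.card_le_card_of_injective (Sum.map Subtype.val id)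
      (Sum.map_injective.2 ⟨Subtype.val_injective, Function.injective_id⟩)) hL)
    (fun s => LinearMap.range (τ (node s.1)).dualMap)
    (Sum.elim (fun _ => H) fun _ => ⊤)
    (Sum.elim (fun W => W.1 ×ˢ Finset.univ)
      fun o => (Finset.univ.filter fun e => node e = o) ×ˢ Finset.univ) (by
    rintro (W | o) s hs
    · rw [hrank]
      simp only [Sum.elim_inl, Finset.card_product, Finset.card_univ, Fintype.card_fin]
      exact (Nat.mul_le_mul_right n W.2).trans (hH _)
    · rw [hrank]
      change ((Finset.univ.filter fun e => node e = o) ×ˢ (Finset.univ : Finset (Fin n))).card ≤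
        Module.finrank L ((⊤ : Submodule L Ω).map (τ (node s.1)))
      rw [Finset.card_product, Finset.card_univ, Fintype.card_fin, hnode, Submodule.map_top,
        LinearMap.range_eq_top.2 (hτ _), finrank_top, Module.finrank_fin_fun])
  choose φ hφ using hvU
  have hφ' : ∀ s ω, v s ω = φ s (τ (node s.1) ω) := fun s ω => by rw [← hφ s]; rfl
  refine ⟨fun e => LinearMap.pi fun a => φ (e, a), fun o x hx => ?_, fun W hW ω => ?_⟩
  · -- The `α n` functionals are independent, so `Φ` is a surjection between equal dimensions.
    set T := (Finset.univ.filter fun e => node e = o) ×ˢ (Finset.univ : Finset (Fin n)) with hT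
    let Φ : (Fin (α * n) → L) →ₗ[L] (T → L) := LinearMap.pi fun s => φ s.1
    have hΦ : Function.Surjective Φ := by
      intro y
      obtain ⟨u, hu⟩ := exists_forall_apply_eq (hv (Sum.inr o)) y
      refine ⟨τ o u.1, funext fun s => ?_⟩
      have hs : node s.1.1 = o := (Finset.mem_filter.1 (Finset.mem_product.1 s.2).1).2
      rw [← hu s]
      change φ s.1 (τ o u.1) = v s.1 u.1
      rw [hφ', hs]
    have hdim : Module.finrank L (Fin (α * n) → L) = Module.finrank L (T → L) := by
      rw [Module.finrank_fin_fun, Module.finrank_fintype_fun_eq_card, Fintype.card_coe, hT,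
        Finset.card_product, hnode, Finset.card_univ, Fintype.card_fin]
    have hinj := (LinearMap.injective_iff_surjective_of_finrank_eq_finrank hdim).2 hΦ
    refine hinj ?_
    rw [map_zero]
    funext s
    exact congrFun (hx s.1.1 (Finset.mem_filter.1 (Finset.mem_product.1 s.2).1).2) s.1.2
  · obtain ⟨u, hu⟩ := exists_forall_apply_eq (hv (Sum.inl ⟨W, hW⟩)) fun s => v s.1 ω
    refine ⟨u.1, u.2, fun e he => funext fun a => ?_⟩
    have := hu ⟨(e, a), Finset.mem_coe.2 (Finset.mem_product.2 ⟨he, Finset.mem_univ a⟩)⟩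
    change φ (e, a) _ = φ (e, a) _
    rw [← hφ' (e, a), ← hφ' (e, a)]
    exact this

end GenericChoice

/-! ### A basis adapted to two column spaces -/

section AdaptedBasis

variable {K : Type u} [Field K] {V : ℕ}

/-- A basis of the column space of `F`, as the columns of `U`, whose first part spans
`⟨F⟩ ∩ ⟨G⟩` and whose second part is independent modulo `⟨G⟩`; the latter independence is witnessed
by `P`, which vanishes on `⟨G⟩`. All data being matrices, they remain valid over extensions. -/
theorem exists_adapted_basis {ι : Type v} {κ : Type w} (F : Matrix (Fin V) ι K)
    (G : Matrix (Fin V) κ K) :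
    ∃ (t s : ℕ) (U : Matrix (Fin V) (Fin t ⊕ Fin s) K) (X : Matrix (Fin t ⊕ Fin s) ι K)
      (Q : Matrix (Fin t ⊕ Fin s) (Fin V) K) (P : Matrix (Fin s) (Fin V) K),
      t = Module.finrank K (colSpan F ⊓ colSpan G : Submodule K (Fin V → K)) ∧
      t + s = Module.finrank K (colSpan F) ∧
      F = U * X ∧ Q * U = 1 ∧ P * G = 0 ∧
      ∀ k k', (P * U) k (Sum.inr k') = if k = k' then 1 else 0 := by
  classical
  obtain ⟨C, hC⟩ := exists_isCompl (colSpan F ⊓ colSpan G)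
  set T := colSpan F ⊓ colSpan G with hT
  set R := C ⊓ colSpan F with hR
  have hsup : T ⊔ R = colSpan F := by
    rw [hR, ← sup_inf_assoc_of_le C (inf_le_left : T ≤ colSpan F), hC.sup_eq_top, top_inf_eq]
  have hinfTR : Disjoint T R := hC.disjoint.mono_right inf_le_left
  have hinfG : Disjoint R (colSpan G) := by
    rw [disjoint_iff, hR, inf_assoc, ← hT]
    exact hC.symm.inf_eq_bot
  let b₁ := Module.finBasis K T
  let b₂ := Module.finBasis K R
  let U : Matrix (Fin V) (Fin (Module.finrank K T) ⊕ Fin (Module.finrank K R)) K :=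
    Matrix.of fun i => Sum.elim (fun k => (b₁ k).1 i) fun k => (b₂ k).1 i
  have hb₁ : Submodule.span K (Set.range fun k => (b₁ k).1) = T := by
    have := congrArg (Submodule.map T.subtype) b₁.span_eq
    rwa [Submodule.map_span, Submodule.map_top, Submodule.range_subtype, ← Set.range_comp] at this
  have hb₂ : Submodule.span K (Set.range fun k => (b₂ k).1) = R := by
    have := congrArg (Submodule.map R.subtype) b₂.span_eq
    rwa [Submodule.map_span, Submodule.map_top, Submodule.range_subtype, ← Set.range_comp] at this
  have hUcol : (fun k i => U i k) = Sum.elim (fun k => (b₁ k).1) fun k => (b₂ k).1 := by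
    funext k
    cases k <;> rfl
  have hUspan : Submodule.span K (Set.range fun k i => U i k) = colSpan F := by
    rw [hUcol, Set.Sum.elim_range, Submodule.span_union, hb₁, hb₂, hsup]
  have hUind : LinearIndependent K fun k i => U i k := by
    rw [hUcol]
    refine LinearIndependent.sum_type (b₁.linearIndependent.map' T.subtype T.ker_subtype)
      (b₂.linearIndependent.map' R.subtype R.ker_subtype) ?_
    change Disjoint (Submodule.span K (Set.range fun k => (b₁ k).1))
      (Submodule.span K (Set.range fun k => (b₂ k).1))
    rw [hb₁, hb₂]
    exact hinfTR
  obtain ⟨Q, hQ⟩ := exists_left_inverse_of_linearIndependent U hUind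
  have hX : ∀ j, ∃ x : Fin (Module.finrank K T) ⊕ Fin (Module.finrank K R) → K,
      ∑ k, x k • (fun i => U i k) = fun i => F i j := fun j => by
    rw [← Submodule.mem_span_range_iff_exists_fun, hUspan]
    exact Submodule.subset_span ⟨j, rfl⟩
  choose X hX using hX
  -- A left inverse of `R → K^V / ⟨G⟩` in coordinates.
  obtain ⟨g, hg⟩ := ((colSpan G).mkQ ∘ₗ R.subtype).exists_leftInverse_of_injective (by
    rw [LinearMap.ker_comp, Submodule.ker_mkQ]
    exact Submodule.disjoint_iff_comap_eq_bot.1 hinfG)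
  let P : Matrix (Fin (Module.finrank K R)) (Fin V) K :=
    LinearMap.toMatrix' (b₂.equivFun.toLinearMap ∘ₗ g ∘ₗ (colSpan G).mkQ)
  have hP : ∀ x : Fin V → K, P.mulVec x = b₂.equivFun (g ((colSpan G).mkQ x)) := fun x => by
    rw [← Matrix.toLin'_apply, Matrix.toLin'_toMatrix']
    rfl
  refine ⟨_, _, U, Matrix.of fun k j => X j k, Q, P, rfl, ?_, ?_, hQ, ?_, ?_⟩
  · have := Submodule.finrank_sup_add_finrank_inf_eq T R
    rw [hsup, hinfTR.eq_bot, finrank_bot, add_zero] at this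
    exact this.symm
  · ext i j
    rw [← congrFun (hX j) i]
    simp only [Finset.sum_apply, Pi.smul_apply, smul_eq_mul, Matrix.mul_apply, Matrix.of_apply]
    exact Finset.sum_congr rfl fun k _ => mul_comm _ _
  · ext k j
    have hmem : (fun i => G i j) ∈ colSpan G := Submodule.subset_span ⟨j, rfl⟩
    have := congrFun (hP fun i => G i j) k
    rw [Submodule.mkQ_apply, (Submodule.Quotient.mk_eq_zero _).2 hmem, map_zero, map_zero] at this
    exact this
  · intro k k'
    have := congrFun (hP (b₂ k').1) k
    rw [show g ((colSpan G).mkQ (b₂ k').1) = b₂ k' from LinearMap.congr_fun hg (b₂ k'),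
      Module.Basis.equivFun_self] at this
    exact this.trans (by simp only [eq_comm])

end AdaptedBasis

/-! ### Encodings for the branch -/

section Achievability

/-- Prescribed linear global encodings give an admissible linear code as in `exists_linear_code`,
provided that every value of the security function occurs while the wiretapped edges carry `0`. -/
theorem exists_admissible_linear_code {𝒱 ℰ S : Type} [Finite 𝒱] [Finite S] [Fintype ℰ]
    {K : Type u} [Field K] [Finite K] (N : Network 𝒱 ℰ S)
    {O : Type w} [Nonempty O] {b ℓ n : ℕ} {z : S → ℕ} (f : (S → K) → O)
    (g : (S → K) →ₗ[K] (Fin b → K)) (𝒲 : Set (Finset ℰ))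
    (Y : ℰ → ((S → Fin ℓ → K) × (∀ i, Fin (z i) → K)) →ₗ[K] (Fin n → K))
    (hsrc : ∀ i e, N.tail e = N.source i →
      ∃ A : ((Fin ℓ → K) × (Fin (z i) → K)) →ₗ[K] (Fin n → K),
        ∀ m k, Y e (m, k) = A (m i, k i))
    (hrel : ∀ e, (¬ ∃ i, N.tail e = N.source i) →
      ∀ ω, (∀ d, N.head d = N.tail e → Y d ω = 0) → Y e ω = 0)
    (hdec : ∀ ω ω', (∀ d, N.head d = N.sink → Y d ω = Y d ω') →
      ∀ j, f (fun i => ω.1 i j) = f (fun i => ω'.1 i j))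
    (hsec : ∀ W ∈ 𝒲, ∀ ω : (S → Fin ℓ → K) × (∀ i, Fin (z i) → K), ∃ ω',
      (∀ e ∈ W, Y e ω' = 0) ∧ ∀ j, g (fun i => ω'.1 i j) = g (fun i => ω.1 i j)) :
    ∃ c : NetworkCode N K K O (fun i => Fin (z i) → K) ℓ n, c.IsLinear ∧
      c.Admissible f g 𝒲 := by
  obtain ⟨c, hlin, henc, hc⟩ := exists_linear_code N f Y hsrc hrel hdec
  refine ⟨c, hlin, hc, fun W hW => ?_⟩
  let X : ((S → Fin ℓ → K) × (∀ i, Fin (z i) → K)) →+ (W → Fin n → K) :=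
    (LinearMap.pi fun e : W => Y e.1).toAddMonoidHom
  let Z : ((S → Fin ℓ → K) × (∀ i, Fin (z i) → K)) →+ (Fin ℓ → Fin b → K) :=
    { toFun := fun o j => g fun i => o.1 i j
      map_zero' := funext fun j => g.map_zero
      map_add' := fun o o' => funext fun j =>
        g.map_add (fun i => o.1 i j) (fun i => o'.1 i j) }
  have hX : (fun o : (S → Fin ℓ → K) × (∀ i, Fin (z i) → K) =>
      fun e : W => c.globalEnc o.1 o.2 e.1) = X := by
    funext o e
    exact henc o.1 o.2 e.1
  rw [hX]
  refine mutualInfo_eq_zero_of_addMonoidHom X Z fun o => ?_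
  obtain ⟨o', h1, h2⟩ := hsec W hW o
  exact ⟨o', funext fun e => h1 e.1 e.2, funext h2⟩

variable {K : Type u} [Field K] [Finite K]

theorem exists_finite_extension (C : ℕ) : ∃ (L : Type) (_ : Field L) (_ : Algebra K L),
    Finite L ∧ C < Nat.card L := by
  obtain ⟨p, hp⟩ := CharP.exists K
  have : Fact p.Prime := ⟨CharP.char_is_prime K p⟩
  refine ⟨FiniteField.Extension K p (C + 1), inferInstance, inferInstance, inferInstance, ?_⟩
  rw [FiniteField.natCard_extension]
  exact (Nat.lt_succ_self C).trans (Nat.lt_pow_self Finite.one_lt_card)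

/-- Combinations of the message symbols of the sources, with coefficients in the small field given
by the columns of `A`, applied to each of the `l` message symbols. -/
def messageComb {K L : Type*} [Field K] [Field L] [Algebra K L] {V l : ℕ} {J κ : Type*}
    (A : Matrix (Fin V) κ K) : (Fin V → Fin l ⊕ J → L) →ₗ[L] (κ × Fin l → L) where
  toFun ω kj := ∑ i, A i kj.1 • ω i (Sum.inl kj.2)
  map_add' ω ω' := by
    funext kj
    simp [Finset.sum_add_distrib]
  map_smul' c ω := by
    funext kj
    simp [Finset.mul_sum]

theorem messageComb_of_mul {K L : Type*} [Field K] [Field L] [Algebra K L] {V l : ℕ}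
    {J κ κ' : Type*} [Fintype κ'] (A : Matrix (Fin V) κ K) (B : Matrix κ' (Fin V) K)
    (y : κ' → Fin l → L) {ω : Fin V → Fin l ⊕ J → L}
    (hω : ∀ i j, ω i (Sum.inl j) = ∑ k, B k i • y k j) (k : κ) (j : Fin l) :
    messageComb A ω (k, j) = ∑ k', (B * A) k' k • y k' j := by
  simp only [messageComb, LinearMap.coe_mk, AddHom.coe_mk, hω, Matrix.mul_apply, Finset.smul_sum,
    Finset.sum_smul, smul_smul]
  rw [Finset.sum_comm]
  simp only [mul_comm]

theorem messageComb_mul {K L : Type*} [Field K] [Field L] [Algebra K L] {V l : ℕ}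
    {J κ κ' : Type*} [Fintype κ'] (U : Matrix (Fin V) κ' K) (X : Matrix κ' κ K)
    (ω : Fin V → Fin l ⊕ J → L) (k : κ) (j : Fin l) :
    messageComb (U * X) ω (k, j) = ∑ k', X k' k • messageComb U ω (k', j) := by
  simp only [messageComb, LinearMap.coe_mk, AddHom.coe_mk, Matrix.mul_apply, Finset.smul_sum,
    Finset.sum_smul, smul_smul]
  rw [Finset.sum_comm]
  simp only [mul_comm]

/-- The vertices of a branch that send messages: a source, or (`none`) the middle node. -/
def branchNode {V α : ℕ} : BranchEdge V α → Option (Fin V)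
  | Sum.inl e => some e.1
  | Sum.inr _ => none

theorem card_filter_branchNode {V α : ℕ} (o : Option (Fin V)) :
    (Finset.univ.filter fun e : BranchEdge V α => branchNode e = o).card = α := by
  cases o with
  | none =>
    rw [show (Finset.univ.filter fun e : BranchEdge V α => branchNode e = none) =
      midEdges V α by
        ext e
        rw [Finset.mem_filter]
        cases e <;> simp [branchNode, midEdges], card_midEdges]
  | some i =>
    rw [show (Finset.univ.filter fun e : BranchEdge V α => branchNode e = some i) =
      outEdges α {i} by
        ext e
        rw [Finset.mem_filter]
        cases e <;> simp [branchNode, outEdges, Prod.ext_iff, eq_comm], card_outEdges]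
    simp

/-- The encodings behind the optimal code, over a large extension `L`. The vector `ω i` consists of
the `l` message symbols of source `i` and of its key. Each edge carries `n` combinations of what
`ω i` or, for an edge from the middle node, the vector of all `ω i` offers: the values of the
target, and key symbols of one source, filling up the `α n` symbols. -/
theorem exists_branch_encoding {V α r n l : ℕ} {ι : Type v} {κ : Type w}
    (F : Matrix (Fin V) ι K) (G : Matrix (Fin V) κ K) (hFG : colSpan F ⊓ colSpan G ≠ ⊥)
    (hr : r ≤ α) (hF : Module.finrank K (colSpan F) * l ≤ α * n)
    (hG : Module.finrank K (colSpan F ⊓ colSpan G : Submodule K (Fin V → K)) * l ≤ (α - r) * n) :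
    ∃ (L : Type) (_ : Field L) (_ : Algebra K L) (_ : Finite L) (z : ℕ)
      (y : BranchEdge V α → (Fin V → Fin l ⊕ Fin z → L) →ₗ[L] (Fin n → L)),
      (∀ i a, ∃ A : (Fin l ⊕ Fin z → L) →ₗ[L] (Fin n → L), ∀ ω, y (Sum.inl (i, a)) ω = A (ω i)) ∧
      (∀ i ω, (∀ a, y (Sum.inl (i, a)) ω = 0) → ω i = 0) ∧
      (∀ ω, (∀ a, y (Sum.inr a) ω = 0) → messageComb F ω = 0) ∧
      ∀ W : Finset (BranchEdge V α), W.card ≤ r → ∀ ω, ∃ u, messageComb G u = 0 ∧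
        ∀ e ∈ W, y e u = y e ω := by
  classical
  obtain ⟨t, s, U, X, Q, P, ht, hts, hUX, hQU, hPG, hPU⟩ := exists_adapted_basis F G
  rw [← ht] at hG
  rw [← hts] at hF
  have ht1 : 1 ≤ t := by
    rw [ht, Nat.one_le_iff_ne_zero]
    exact fun h => hFG (Submodule.finrank_eq_zero.1 h)
  have hV : Nonempty (Fin V) := by
    by_contra h
    rw [not_nonempty_iff] at h
    exact hFG (Subsingleton.elim _ _)
  have i₀ : Fin V := Classical.arbitrary _
  have hrn : (α - r) * n = α * n - r * n := Nat.sub_mul _ _ _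
  have hrn' : r * n ≤ α * n := Nat.mul_le_mul_right _ hr
  have hl : l ≤ t * l := Nat.le_mul_of_pos_left _ ht1
  have hl' : t * l ≤ (t + s) * l := Nat.mul_le_mul_right _ (Nat.le_add_right _ _)
  have hts' : (t + s) * l = t * l + s * l := add_mul _ _ _
  obtain ⟨L, _, _, _, hL⟩ := exists_finite_extension (K := K)
    (Nat.card (Finset (BranchEdge V α) ⊕ Option (Fin V)))
  -- Lengths of the keys and of the part of a key that the middle node forwards.
  set z := α * n - l with hz
  set q := α * n - (t + s) * l with hq
  have hqz : q ≤ z := by omega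
  -- What the middle node forwards: the target in adapted coordinates, and `q` key symbols.
  let keys : (Fin V → Fin l ⊕ Fin z → L) →ₗ[L] (Fin q → L) :=
    LinearMap.pi fun a => LinearMap.proj (Sum.inr (Fin.castLE hqz a)) ∘ₗ LinearMap.proj i₀
  let Φ : (Fin V → Fin l ⊕ Fin z → L) →ₗ[L] (((Fin t ⊕ Fin s) × Fin l) ⊕ Fin q → L) :=
    (LinearEquiv.sumArrowLequivProdArrow _ _ L L).symm.toLinearMap ∘ₗ
      (messageComb U).prod keys
  have e₁ : (Fin l ⊕ Fin z → L) ≃ₗ[L] (Fin (α * n) → L) := LinearEquiv.ofFinrankEq _ _ (by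
    simp only [Module.finrank_fintype_fun_eq_card, Fintype.card_sum, Fintype.card_fin]
    omega)
  have e₂ : (((Fin t ⊕ Fin s) × Fin l) ⊕ Fin q → L) ≃ₗ[L] (Fin (α * n) → L) :=
    LinearEquiv.ofFinrankEq _ _ (by
      simp only [Module.finrank_fintype_fun_eq_card, Fintype.card_sum, Fintype.card_prod,
        Fintype.card_fin]
      omega)
  let τ : Option (Fin V) → (Fin V → Fin l ⊕ Fin z → L) →ₗ[L] (Fin (α * n) → L) := fun o =>
    o.elim (e₂.toLinearMap ∘ₗ Φ) fun i => e₁.toLinearMap ∘ₗ LinearMap.proj i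
  have hΦ : Function.Surjective Φ := by
    intro c
    refine ⟨fun i => Sum.elim (fun j => ∑ k, Q k i • c (Sum.inl (k, j)))
      fun a => if h : a.1 < q then c (Sum.inr ⟨a.1, h⟩) else 0, ?_⟩
    funext x
    rcases x with ⟨k, j⟩ | a
    · change messageComb U _ (k, j) = _
      rw [messageComb_of_mul U Q (fun k j => c (Sum.inl (k, j))) (fun i j => rfl), hQU]
      simp [Matrix.one_apply]
    · change dite _ _ _ = _
      rw [dif_pos (show (Fin.castLE hqz a).1 < q from a.2)]
      rfl
  obtain ⟨θ, hθ, hsec⟩ := exists_generic_encoding (branchNode (V := V) (α := α))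
    card_filter_branchNode hL (LinearMap.ker (messageComb G)) τ (r := r) (by
    rintro (_ | i)
    · exact e₂.surjective.comp hΦ
    · exact e₁.surjective.comp (LinearMap.proj_surjective i)) (by
    rintro (_ | i)
    · -- On the kernel, the coordinates independent modulo `⟨G⟩` and the keys are arbitrary.
      let Ψ : (((Fin t ⊕ Fin s) × Fin l) ⊕ Fin q → L) →ₗ[L] ((Fin s × Fin l) ⊕ Fin q → L) :=
        LinearMap.funLeft L L (Sum.map (Prod.map Sum.inr id) id)
      have hΨ : ((LinearMap.ker (messageComb G)).map (τ none)).map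
          (Ψ ∘ₗ e₂.symm.toLinearMap) = ⊤ := by
        refine Submodule.eq_top_iff'.2 fun c => ?_
        rw [← Submodule.map_comp]
        refine ⟨fun i => Sum.elim (fun j => ∑ k, P k i • c (Sum.inl (k, j)))
          fun a => if h : a.1 < q then c (Sum.inr ⟨a.1, h⟩) else 0, ?_, ?_⟩
        · refine LinearMap.mem_ker.2 (funext fun kj => ?_)
          rw [messageComb_of_mul G P (fun k j => c (Sum.inl (k, j))) (fun i j => rfl), hPG]
          simp
        · change Ψ (e₂.symm (e₂ (Φ _))) = c
          rw [e₂.symm_apply_apply]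
          funext x
          rcases x with ⟨k, j⟩ | a
          · change messageComb U _ (Sum.inr k, j) = _
            rw [messageComb_of_mul U P (fun k j => c (Sum.inl (k, j))) (fun i j => rfl)]
            simp [hPU]
          · change dite _ _ _ = _
            rw [dif_pos (show (Fin.castLE hqz (id a)).1 < q from a.2)]
            rfl
      have h1 := Submodule.finrank_map_le (Ψ ∘ₗ e₂.symm.toLinearMap)
        ((LinearMap.ker (messageComb G)).map (τ none))
      rw [hΨ, finrank_top] at h1
      simp only [Module.finrank_fintype_fun_eq_card, Fintype.card_sum, Fintype.card_prod,
        Fintype.card_fin] at h1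
      refine le_trans ?_ h1
      omega
    · -- On the kernel, the key of each source is arbitrary.
      have hΨ : ((LinearMap.ker (messageComb G)).map (τ (some i))).map
          (LinearMap.funLeft L L (Sum.inr : Fin z → Fin l ⊕ Fin z) ∘ₗ e₁.symm.toLinearMap) =
            ⊤ := by
        refine Submodule.eq_top_iff'.2 fun c => ?_
        rw [← Submodule.map_comp]
        refine ⟨fun i => Sum.elim 0 c, ?_, ?_⟩
        · refine LinearMap.mem_ker.2 (funext fun kj => ?_)
          simp [messageComb]
        · change LinearMap.funLeft L L Sum.inr (e₁.symm (e₁ (Sum.elim 0 c))) = c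
          rw [e₁.symm_apply_apply]
          rfl
      have h1 := Submodule.finrank_map_le
        (LinearMap.funLeft L L (Sum.inr : Fin z → Fin l ⊕ Fin z) ∘ₗ e₁.symm.toLinearMap)
        ((LinearMap.ker (messageComb G)).map (τ (some i)))
      rw [hΨ, finrank_top, Module.finrank_fin_fun] at h1
      refine le_trans ?_ h1
      omega)
  refine ⟨L, _, _, ‹_›, z, fun e => θ e ∘ₗ τ (branchNode e),
    fun i a => ⟨θ _ ∘ₗ e₁.toLinearMap, fun ω => rfl⟩, fun i ω h => ?_, fun ω h => ?_, hsec⟩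
  · refine e₁.map_eq_zero_iff.1 (hθ (some i) (e₁ (ω i)) ?_)
    rintro (⟨i', a⟩ | a) he
    · obtain rfl : i' = i := Option.some_injective _ he
      exact h a
    · cases he
  · have hω : Φ ω = 0 := by
      refine e₂.map_eq_zero_iff.1 (hθ none (e₂ (Φ ω)) ?_)
      rintro (e | a) he
      · cases he
      · exact h a
    funext ⟨k, j⟩
    rw [hUX, messageComb_mul]
    refine Finset.sum_eq_zero fun k' _ => ?_
    rw [show messageComb U ω (k', j) = 0 from congrFun hω (Sum.inl (k', j)), smul_zero]

end Achievability

/-! ### The optimal code -/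

section OptimalCode

variable {K : Type u} [Field K] [Finite K] {V α : ℕ} {hα : 0 < α}

/-- Over the small field the encodings of `exists_branch_encoding` become an admissible linear code:
identify the vectors over the extension of degree `N` with vectors `N` times as long. Any linear
identification of the messages commutes with the target and security functions. -/
theorem exists_admissible_linear_code_branch {r n l a b : ℕ}
    (F : Matrix (Fin V) (Fin a) K) (G : Matrix (Fin V) (Fin b) K)
    (hFG : colSpan F ⊓ colSpan G ≠ ⊥) (hr : r ≤ α)
    (hF : Module.finrank K (colSpan F) * l ≤ α * n)
    (hG : Module.finrank K (colSpan F ⊓ colSpan G : Submodule K (Fin V → K)) * l ≤ (α - r) * n) :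
    ∃ (N : ℕ) (z : Fin V → ℕ) (c : NetworkCode (branch V α hα) K K (Fin a → K)
      (fun i => Fin (z i) → K) (l * N) (n * N)),
      0 < N ∧ c.IsLinear ∧ c.Admissible (linFun F) (linFun G) (wiretapSets _ r) := by
  classical
  obtain ⟨L, _, _, _, z, y, hsrc, hinj, hdec, hsec⟩ := exists_branch_encoding F G hFG hr hF hG
  have : Module.Finite K L := Module.Finite.of_finite
  set N := Module.finrank K L with hN
  have hdim : ∀ k, Module.finrank K (Fin (k * N) → K) = Module.finrank K (Fin k → L) := fun k => by
    rw [Module.finrank_fin_fun, Module.finrank_pi_fintype]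
    simp [hN]
  let φ (k : ℕ) : (Fin (k * N) → K) ≃ₗ[K] (Fin k → L) := LinearEquiv.ofFinrankEq _ _ (hdim k)
  let ψ : ((Fin (l * N) → K) × (Fin (z * N) → K)) ≃ₗ[K] (Fin l ⊕ Fin z → L) :=
    ((φ l).prodCongr (φ z)).trans (LinearEquiv.sumArrowLequivProdArrow _ _ K L).symm
  let lift : ((Fin V → Fin (l * N) → K) × (Fin V → Fin (z * N) → K)) →ₗ[K]
      (Fin V → Fin l ⊕ Fin z → L) := LinearMap.pi fun i => ψ.toLinearMap ∘ₗ
        (LinearMap.proj i).prodMap (LinearMap.proj i)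
  let Y : BranchEdge V α → ((Fin V → Fin (l * N) → K) × (Fin V → Fin (z * N) → K)) →ₗ[K]
      (Fin (n * N) → K) := fun e =>
    (φ n).symm.toLinearMap ∘ₗ (y e).restrictScalars K ∘ₗ lift
  have hY : ∀ e ω, Y e ω = 0 ↔ y e (lift ω) = 0 := fun e ω => (φ n).symm.map_eq_zero_iff
  -- A combination of the messages with coefficients in `K` vanishes as soon as its lift does.
  have hcomb : ∀ {k : ℕ} (A : Matrix (Fin V) (Fin k) K) ω, messageComb A (lift ω) = 0 →
      ∀ j, linFun A (fun i => ω.1 i j) = 0 := by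
    intro k A ω h j
    funext c
    have h1 : φ l (∑ i, A i c • ω.1 i) = 0 := by
      rw [map_sum]
      funext j'
      simp only [map_smul, Finset.sum_apply, Pi.smul_apply]
      exact congrFun h (c, j')
    have h2 := congrFun ((φ l).map_eq_zero_iff.1 h1) j
    simp only [Finset.sum_apply, Pi.smul_apply, smul_eq_mul] at h2
    refine Eq.trans ?_ h2
    simp [linFun, Matrix.vecMul, dotProduct, mul_comm]
  suffices h : ∃ c : NetworkCode (branch V α hα) K K (Fin a → K) (fun _ => Fin (z * N) → K)
      (l * N) (n * N), c.IsLinear ∧ c.Admissible (linFun F) (linFun G) (wiretapSets _ r) by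
    obtain ⟨c, hlin, hc⟩ := h
    exact ⟨N, fun _ => z * N, c, Module.finrank_pos, hlin, hc⟩
  refine exists_admissible_linear_code (branch V α hα) (z := fun _ => z * N)
    (linFun F) (Matrix.vecMulLinear G) (wiretapSets _ r) Y ?_ ?_ ?_ ?_
  · rintro i (⟨i', a⟩ | a) he
    · obtain rfl : i' = i := by
        change BranchVertex.src i' = BranchVertex.src i at he
        injection he
      obtain ⟨A, hA⟩ := hsrc i' a
      refine ⟨(φ n).symm.toLinearMap ∘ₗ A.restrictScalars K ∘ₗ ψ.toLinearMap, fun m k => ?_⟩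
      exact congrArg (φ n).symm (hA (lift (m, k)))
    · cases he
  · rintro (⟨i, a⟩ | a) he ω hω
    · exact absurd ⟨i, rfl⟩ he
    · have hzero : lift ω = 0 := funext fun i =>
        hinj i _ fun a' => (hY _ _).1 (hω (Sum.inl (i, a')) rfl)
      rw [hY, hzero, map_zero]
  · intro ω ω' h j
    have h1 := hcomb F (ω - ω') (hdec _ fun a => (hY _ _).1 (by
      rw [map_sub, h (Sum.inr a) rfl, sub_self])) j
    rw [← sub_eq_zero, ← h1]
    exact (Matrix.sub_vecMul F _ _).symm
  · intro W hW ω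
    obtain ⟨u, hu, huW⟩ := hsec W hW (lift ω)
    obtain ⟨ω₀, rfl⟩ : ∃ ω₀, lift ω₀ = u :=
      ⟨(fun i => (ψ.symm (u i)).1, fun i => (ψ.symm (u i)).2),
        funext fun i => ψ.apply_symm_apply (u i)⟩
    refine ⟨ω - ω₀, fun e he => ?_, fun j => ?_⟩
    · rw [hY, map_sub, map_sub, huW e he, sub_self]
    · have h1 := hcomb G ω₀ hu j
      change linFun G ((fun i => ω.1 i j) - fun i => ω₀.1 i j) = linFun G _
      rw [linFun, Matrix.sub_vecMul]
      exact (congrArg _ h1).trans (sub_zero _)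

/-- The code transmitting nothing at all. -/
theorem exists_admissible_linear_code_zero {r a b : ℕ}
    (F : Matrix (Fin V) (Fin a) K) (G : Matrix (Fin V) (Fin b) K) :
    ∃ (z : Fin V → ℕ) (c : NetworkCode (branch V α hα) K K (Fin a → K)
      (fun i => Fin (z i) → K) 0 1),
      c.IsLinear ∧ c.Admissible (linFun F) (linFun G) (wiretapSets _ r) := by
  obtain ⟨c, hlin, hc⟩ := exists_admissible_linear_code (branch V α hα) (z := fun _ => 0)
    (ℓ := 0) (n := 1) (linFun F) (Matrix.vecMulLinear G) (wiretapSets _ r) (fun _ => 0)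
    (fun _ _ _ => ⟨0, fun _ _ => rfl⟩) (fun _ _ _ _ => rfl) (fun _ _ _ j => j.elim0)
    (fun _ _ ω => ⟨ω, fun _ _ => rfl, fun j => j.elim0⟩)
  exact ⟨_, c, hlin, hc⟩

end OptimalCode

end SecureComputation

open SecureComputation in
theorem mainTheorem4 {K : Type*} [Field K] [Finite K] (V α r a b : ℕ) (hα : 0 < α)
    (F : Matrix (Fin V) (Fin a) K) (G : Matrix (Fin V) (Fin b) K)
    (hFG : colSpan F ⊓ colSpan G ≠ ⊥) :
    ∃ p t : ℝ, IsLeast (pairBounds (branch V α hα) F G r) p ∧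
      IsLeast (tripleBounds (branch V α hα) F G r) t ∧
      IsGreatest (rateRegion (branch V α hα) K (linFun F) (linFun G) r)
        (min ((α : ℝ) / (F.rank : ℝ)) (min p t)) ∧
      ∃ (ℓ n : ℕ) (z : Fin V → ℕ)
        (c : NetworkCode (branch V α hα) K K (Fin a → K) (fun i => Fin (z i) → K) ℓ n),
        0 < n ∧ c.IsLinear ∧ c.Admissible (linFun F) (linFun G) (wiretapSets _ r) ∧
          (ℓ : ℝ) / (n : ℝ) = min ((α : ℝ) / (F.rank : ℝ)) (min p t) := by
  obtain ⟨hpair, htriple⟩ := isLeast_bounds hα F G r hFG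
  refine ⟨_, _, hpair, htriple, ?_⟩
  rw [min_self]
  have hrank : F.rank = Module.finrank K (colSpan F) := Matrix.rank_eq_finrank_span_cols F
  set d := Module.finrank K (colSpan F ⊓ colSpan G : Submodule K (Fin V → K)) with hd
  have hd0 : 0 < d := Nat.pos_of_ne_zero fun h => hFG (Submodule.finrank_eq_zero.1 h)
  have hdF : d ≤ F.rank := by
    rw [hrank]
    exact Submodule.finrank_mono inf_le_left
  have hF0 : 0 < F.rank := hd0.trans_le hdF
  have hd0' : (0 : ℝ) < d := Nat.cast_pos.2 hd0
  have hF0' : (0 : ℝ) < F.rank := Nat.cast_pos.2 hF0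
  have hcode : ∃ (ℓ n : ℕ) (z : Fin V → ℕ)
      (c : NetworkCode (branch V α hα) K K (Fin a → K) (fun i => Fin (z i) → K) ℓ n),
      0 < n ∧ c.IsLinear ∧ c.Admissible (linFun F) (linFun G) (wiretapSets _ r) ∧
        (ℓ : ℝ) / (n : ℝ) = min ((α : ℝ) / (F.rank : ℝ)) (((α - r : ℕ) : ℝ) / d) := by
    obtain hr | hr := le_total α r
    · obtain ⟨z, c, hlin, hc⟩ := exists_admissible_linear_code_zero (hα := hα) (r := r) F G
      refine ⟨0, 1, z, c, one_pos, hlin, hc, ?_⟩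
      rw [Nat.sub_eq_zero_of_le hr, Nat.cast_zero, zero_div, zero_div,
        min_eq_right (by positivity)]
    -- This choice makes `l / n` the minimum of the two quotients.
    · obtain ⟨N, z, c, hN, hlin, hc⟩ := exists_admissible_linear_code_branch (hα := hα) (r := r)
        (n := F.rank * d) (l := min (α * d) ((α - r) * F.rank)) F G hFG hr
        (by
          rw [← hrank]
          calc F.rank * min (α * d) ((α - r) * F.rank) ≤ F.rank * (α * d) :=
              Nat.mul_le_mul_left _ (min_le_left _ _)
            _ = α * (F.rank * d) := by ring)
        (by
          calc d * min (α * d) ((α - r) * F.rank) ≤ d * ((α - r) * F.rank) :=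
              Nat.mul_le_mul_left _ (min_le_right _ _)
            _ = (α - r) * (F.rank * d) := by ring)
      refine ⟨_, _, z, c, Nat.mul_pos (Nat.mul_pos hF0 hd0) hN, hlin, hc, ?_⟩
      have hN' : (N : ℝ) ≠ 0 := Nat.cast_ne_zero.2 hN.ne'
      rw [Nat.cast_mul, Nat.cast_mul, mul_div_mul_right _ _ hN', Nat.cast_min, Nat.cast_mul,
        Nat.cast_mul, Nat.cast_mul, ← min_div_div_right (by positivity),
        mul_div_mul_right _ _ hd0'.ne', mul_comm (F.rank : ℝ), mul_div_mul_right _ _ hF0'.ne']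
  refine ⟨⟨⟨?_, ?_⟩, ?_⟩, hcode⟩
  · positivity
  · intro ε hε
    obtain ⟨ℓ, n, z, c, hn, -, hc, hrate⟩ := hcode
    exact ⟨ℓ, n, fun i => Fin (z i) → K, inferInstance, inferInstance, c, hn, hc, by linarith⟩
  · rintro R ⟨-, hR⟩
    refine le_of_forall_pos_le_add fun ε hε => ?_
    obtain ⟨ℓ, n, Key, _, _, c, hn, hc, hrate⟩ := hR ε hε
    have hn' : (0 : ℝ) < n := Nat.cast_pos.2 hn
    have h1 := rank_mul_le_of_admissible c hc
    have h2 := finrank_inf_mul_le_of_admissible c hc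
    have h3 : (ℓ : ℝ) / n ≤ min ((α : ℝ) / (F.rank : ℝ)) (((α - r : ℕ) : ℝ) / d) := by
      refine le_min ?_ ?_
      · rw [div_le_div_iff₀ hn' hF0', mul_comm, mul_comm (α : ℝ)]
        exact_mod_cast h1
      · rw [div_le_div_iff₀ hn' hd0', mul_comm, mul_comm (((α - r : ℕ) : ℝ))]
        exact_mod_cast h2
    linarith
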